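/- **Setting.** Let $N\ge 2$, let $p_1,\dots,p_N\in\mathbb R^{N-1}$ satisfy $|p_i-p_j|=1$ for $i\ne j$, and put $F_i(x)=\frac12x+\frac12p_i$. Let $V_0=\{p_1,\dots,p_N\}$, $V_{m+1}=\bigcup_{i=1}^N F_i(V_m)$, and let $V=\overline{\bigcup_m V_m}$ be the Sierpinski gasket. For $x,y\in V_m$ write $x\sim_m y$ if $x$ and $y$ lie in a common cell $F_{w_1}\circ\dots\circ F_{w_m}(V)$ of level $m$. For $u\in C(V)$ let $$W_m(u)=\frac12\Big(\frac{N+2}{N}\Big)^m\sum_{x,y\in V_m,\;x\sim_m y}(u(x)-u(y))^2,\qquad W(u)=\lim_{m\to\infty}W_m(u)\in[0,\infty]$$ (the sum is over ordered pairs; the sequence is increasing in $m$), and let $H^1(V)=\{u\in C(V): W(u)<\infty\}$. Let $\mu$ be a finite Borel measure on $V$ such that every nonempty relatively open subset of $V$ has positive measure and $\mu(V_0)=0$. For $B=(B_1,\dots,B_N)$ with $B_i:\mathbb R\to[0,\infty]$ define $W_B:L^2_\mu(V)\to[0,\infty]$ by $W_B(u)=W(u)+\sum_{i=1}^NB_i(u(p_i))$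 if $u\in H^1(V)$ and $W_B(u)=\infty$ otherwise. $B$ is *normalised* if $B_i(0)=0$ for all $i$. The subgradient of $\tilde W:H\to[0,\infty]$ on a real Hilbert space $H$ at a point $u$ with $\tilde W(u)<\infty$ is $\partial\tilde W(u)=\{f\in H:\tilde W(u+v)-\tilde W(u)\ge\langle f,v\rangle\ \forall v\in H\}$ (and it is empty at the other points). The *semigroup generated by $\tilde W$* is the family $S=(S(t))_{t\ge0}$ on $\overline{\{\tilde W<\infty\}}$ for which $u(t)=S(t)u_0$ is the solution $u\in C([0,\infty);H)\cap H^1_{loc}((0,\infty);H)$ of $\dot u+\partial\tilde W(u)\ni0$ a.e. on $(0,\infty)$, $u(0)=u_0$. A family $S=(S(t))_{t\ge0}$ of maps on $L^2_\mu(V)$ is *positive* if $u\ge0$ implies $S(t)u\ge0$ for all $t\ge 0$; *order preserving* if $u\le v$ implies $S(t)u\le S(t)v$ for all $t\ge 0$; *$L^\infty$-contractive* if $\|S(t)u-S(t)v\|_{L^\infty}\le\|u-v\|_{L^\infty}$ (in $[0,\infty]$) for all $t\ge0$ and all $u,v\in L^2_\mu(V)$. $S_1$ is *dominated* by $S_2$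 if $S_2$ is order preserving and $|u|\le v$ implies $|S_1(t)u|\le S_2(t)v$ for all $t\ge0$; it is *totally dominated* by $S_2$ if it is dominated both by $S_2$ and by $-S_2(-\,\cdot\,)$. A function on $\mathbb R$ with values in $[-\infty,\infty]$ is *bi-monotone* if it is decreasing on $(-\infty,0]$ and increasing on $[0,\infty)$. **Theorem.** Let $B=(B_1,\dots,B_N)$ be normalised and assume that $W_B$ is convex and lower semicontinuous on $L^2_\mu(V)$. Then $\{W_B<\infty\}$ is dense in $L^2_\mu(V)$, and $W_B$ generates a unique semigroup $S_B$, which is therefore defined on all of $L^2_\mu(V)$. Moreover: 1. $S_B$ is positive and order preserving. 2. If every $B_i$ is convex, then $S_B$ is $L^\infty$-contractive. Let $\hat B=(\hat B_1,\dots,\hat B_N)$ be a second normalised tuple for which $W_{\hat B}$ is convex and lower semicontinuous, and let $S_{\hat B}$ be the semigroup generated by $W_{\hat B}$. With the convention $\infty-\infty=\infty$: 3. If $s\mapsto\hat B_i(s)-B_i(|s|)$ is bi-monotone for every $i$, then $S_{\hat B}$ is dominated by $S_B$. 4. If $s\mapsto\hat B_i(s)-B_i(|s|)$ and $s\mapsto\hat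 B_i(s)-B_i(-|s|)$ are bi-monotone for every $i$, then $S_{\hat B}$ is totally dominated by $S_B$. -/

import Mathlib

open MeasureTheory Filter Set
open scoped ENNReal NNReal

noncomputable section

namespace Gasket

/-! ### The Sierpinski gasket -/

/-- The space `ℝ^(N-1)` with the Euclidean norm. -/
abbrev Space (N : ℕ) : Type := EuclideanSpace ℝ (Fin (N - 1))

/-- The similarity `F_i x = x / 2 + p_i / 2`. -/
def simMap {N : ℕ} (p : Fin N → Space N) (i : Fin N) (x : Space N) : Space N :=
  (1 / 2 : ℝ) • x + (1 / 2 : ℝ) • p i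

/-- `F_w = F_{w_1} ∘ ⋯ ∘ F_{w_m}` for a word `w = (w_1, …, w_m)`. -/
def wordMap {N : ℕ} (p : Fin N → Space N) : List (Fin N) → Space N → Space N
  | [] => id
  | i :: w => simMap p i ∘ wordMap p w

/-- `V_0 = {p_1, …, p_N}` and `V_{m+1} = ⋃ i, F_i (V_m)`. -/
def vertexSet {N : ℕ} (p : Fin N → Space N) : ℕ → Set (Space N)
  | 0 => Set.range p
  | m + 1 => ⋃ i, simMap p i '' vertexSet p m

/-- The Sierpinski gasket `V`, the closure of `V_* = ⋃ m, V_m`. -/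
def gasket {N : ℕ} (p : Fin N → Space N) : Set (Space N) :=
  closure (⋃ m, vertexSet p m)

theorem vertexSet_finite {N : ℕ} (p : Fin N → Space N) (m : ℕ) : (vertexSet p m).Finite := by
  induction m with
  | zero => exact Set.finite_range p
  | succ m ih => exact Set.finite_iUnion fun i => ih.image _

theorem vertexSet_subset_gasket {N : ℕ} (p : Fin N → Space N) (m : ℕ) :
    vertexSet p m ⊆ gasket p :=
  (Set.subset_iUnion (vertexSet p) m).trans subset_closure

/-- The set `V_m`, as a finite set of points of `V`. -/
def vertices {N : ℕ} (p : Fin N → Space N) (m : ℕ) : Finset (gasket p) :=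
  ((vertexSet_finite p m).preimage
    (Subtype.val_injective (p := (· ∈ gasket p))).injOn).toFinset

theorem mem_vertices {N : ℕ} (p : Fin N → Space N) (m : ℕ) (x : gasket p) :
    x ∈ vertices p m ↔ (x : Space N) ∈ vertexSet p m := by
  simp [vertices]

/-- The boundary point `p_i`, as a point of `V`. -/
def bdry {N : ℕ} (p : Fin N → Space N) (i : Fin N) : gasket p :=
  ⟨p i, vertexSet_subset_gasket p 0 ⟨i, rfl⟩⟩

/-- `x` and `y` lie in a common cell `F_w(V)` of level `m`. -/
def SameCell {N : ℕ} (p : Fin N → Space N) (m : ℕ) (x y : gasket p) : Prop :=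
  ∃ w : List (Fin N), w.length = m ∧
    (x : Space N) ∈ wordMap p w '' gasket p ∧ (y : Space N) ∈ wordMap p w '' gasket p

/-! ### The energy -/

open Classical in
/-- The `m`-energy `W_m(u)`; the sum runs over ordered pairs of points of `V_m`. -/
def energyAt {N : ℕ} (p : Fin N → Space N) (m : ℕ) (u : gasket p → ℝ) : ℝ :=
  (1 / 2) * (((N : ℝ) + 2) / N) ^ m *
    ∑ x ∈ vertices p m, ∑ y ∈ vertices p m, if SameCell p m x y then (u x - u y) ^ 2 else 0

/-- The energy `W(u) = lim W_m(u) ∈ [0, ∞]`. The sequence `W_m(u)` is increasing, so that the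
limit exists and is the lower limit. -/
def energy {N : ℕ} (p : Fin N → Space N) (u : gasket p → ℝ) : ℝ≥0∞ :=
  liminf (fun m => ENNReal.ofReal (energyAt p m u)) atTop

/-- The space `H^1(V)` of continuous functions of finite energy. -/
def sobolev {N : ℕ} (p : Fin N → Space N) : Set C(gasket p, ℝ) :=
  {u | energy p u < ∞}

/-- The perturbed energy `W_B` on `L²_μ(V)`. When `μ` charges every nonempty open set, an element
of `L²_μ(V)` has at most one continuous representative, so that the infimum below is over at most
one function; over the empty set it is `∞`. -/
def perturbedEnergy {N : ℕ} (p : Fin N → Space N) (μ : Measure (gasket p))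
    (B : Fin N → ℝ → ℝ≥0∞) (f : Lp ℝ 2 μ) : ℝ≥0∞ :=
  ⨅ (u : C(gasket p, ℝ)) (_ : u ∈ sobolev p ∧ (u : gasket p → ℝ) =ᵐ[μ] f),
    energy p u + ∑ i, B i (u (bdry p i))

end Gasket

/-! ### Convex energies on Hilbert spaces and the semigroups they generate -/

/-- Convexity of a function with values in `[0, ∞]`. -/
def ConvexEnergy {E : Type*} [AddCommGroup E] [Module ℝ E] (W : E → ℝ≥0∞) : Prop :=
  ∀ u v : E, ∀ a b : ℝ, 0 ≤ a → 0 ≤ b → a + b = 1 →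
    W (a • u + b • v) ≤ ENNReal.ofReal a * W u + ENNReal.ofReal b * W v

/-- The effective domain `{W < ∞}`. -/
def effDomain {E : Type*} (W : E → ℝ≥0∞) : Set E := {u | W u < ∞}

/-- The subgradient of `W` at `u`; it is empty outside the effective domain. -/
def subgradient {H : Type*} [NormedAddCommGroup H] [InnerProductSpace ℝ H]
    (W : H → ℝ≥0∞) (u : H) : Set H :=
  {f | u ∈ effDomain W ∧
    ∀ v : H, (W u : EReal) + ((inner ℝ f v : ℝ) : EReal) ≤ (W (u + v) : EReal)}

/-- `u ∈ C([0,∞); H) ∩ H^1_loc((0,∞); H)` solves `u' + ∂W(u) ∋ 0` almost everywhere on `(0,∞)`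
and `u(0) = u₀`. Here `g` is the weak derivative of `u`: a continuous function is in
`H^1_loc((0,∞); H)` with weak derivative `g` iff `g` is locally square integrable on `(0,∞)` and
`u` is a primitive of `g`. -/
def IsGradientFlow {H : Type*} [NormedAddCommGroup H] [InnerProductSpace ℝ H]
    (W : H → ℝ≥0∞) (u₀ : H) (u : ℝ≥0 → H) : Prop :=
  Continuous u ∧ u 0 = u₀ ∧
    ∃ g : ℝ → H,
      (∀ a b : ℝ, 0 < a → a < b → MemLp g 2 (volume.restrict (Set.Icc a b))) ∧
      (∀ a b : ℝ≥0, 0 < a → a < b → u b - u a = ∫ t in (a : ℝ)..(b : ℝ), g t) ∧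
      ∀ᵐ t ∂(volume.restrict (Set.Ioi (0 : ℝ))), -g t ∈ subgradient W (u t.toNNReal)

/-- `S` is the semigroup generated by `W` on the closure of the effective domain of `W`:
`t ↦ S(t)u₀` is the solution of the Cauchy problem with initial value `u₀`. -/
def IsGeneratedBy {H : Type*} [NormedAddCommGroup H] [InnerProductSpace ℝ H]
    (W : H → ℝ≥0∞) (S : ℝ≥0 → H → H) : Prop :=
  ∀ u₀ ∈ closure (effDomain W), IsGradientFlow W u₀ (fun t => S t u₀)

/-! ### Qualitative properties of semigroups on `L²` -/

section Properties

variable {X : Type*} [MeasurableSpace X] {μ : Measure X}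

/-- Positivity. -/
def IsPositiveSG (S : ℝ≥0 → Lp ℝ 2 μ → Lp ℝ 2 μ) : Prop :=
  ∀ (t : ℝ≥0) (u : Lp ℝ 2 μ), 0 ≤ u → 0 ≤ S t u

/-- Order preservation. -/
def IsOrderPreserving (S : ℝ≥0 → Lp ℝ 2 μ → Lp ℝ 2 μ) : Prop :=
  ∀ (t : ℝ≥0) (u v : Lp ℝ 2 μ), u ≤ v → S t u ≤ S t v

/-- `L^∞`-contractivity; the norms may be infinite. -/
def IsLinftyContractive (S : ℝ≥0 → Lp ℝ 2 μ → Lp ℝ 2 μ) : Prop :=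
  ∀ (t : ℝ≥0) (u v : Lp ℝ 2 μ),
    eLpNorm (S t u - S t v : Lp ℝ 2 μ) ∞ μ ≤ eLpNorm (u - v : Lp ℝ 2 μ) ∞ μ

/-- `S₁` is dominated by `S₂`. -/
def IsDominatedBy (S₁ S₂ : ℝ≥0 → Lp ℝ 2 μ → Lp ℝ 2 μ) : Prop :=
  IsOrderPreserving S₂ ∧
    ∀ (t : ℝ≥0) (u v : Lp ℝ 2 μ), |u| ≤ v → |S₁ t u| ≤ S₂ t v

/-- `S₁` is totally dominated by `S₂`. -/
def IsTotallyDominatedBy (S₁ S₂ : ℝ≥0 → Lp ℝ 2 μ → Lp ℝ 2 μ) : Prop :=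
  IsDominatedBy S₁ S₂ ∧ IsDominatedBy S₁ (fun t u => -S₂ t (-u))

end Properties

/-! ### Bi-monotone functions -/

/-- Decreasing on `(-∞, 0]` and increasing on `[0, ∞)`. -/
def IsBimonotone (D : ℝ → EReal) : Prop :=
  AntitoneOn D (Set.Iic 0) ∧ MonotoneOn D (Set.Ici 0)

open Classical in
/-- The difference `a - b` of elements of `[0, ∞]`, with `∞ - ∞ = ∞`. -/
def extSub (a b : ℝ≥0∞) : EReal :=
  if a = ∞ then ⊤ else (a : EReal) - (b : EReal)

end

open scoped Topology

/-!
For a convex, lower semicontinuous energy on a Hilbert space the resolvents of the subgradient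
exist, and the implicit Euler scheme built from them converges to a gradient flow. The comparison
properties come from truncation: if `w = (u - v - k)⁺`, then replacing `(u, v)` by
`(u - w, v + w)` does not increase the sum of the two perturbed energies. Testing the two
subgradient inequalities with `-w` and `w` shows that `‖(u - v - k)⁺‖²` is nonincreasing along
two gradient flows. With `k = 0` this gives uniqueness and order preservation, with `k > 0` the
`L^∞`-contractivity, and applied to `±u` it gives domination, the bi-monotonicity of the
difference of the boundary terms being exactly what the truncation needs there.

The unperturbed energy is monotone in the level because harmonic extension to the next level
scales the energy of a cell by `N / (N + 2)`. The piecewise harmonic functions obtained by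
iterating this extension have finite energy and are uniformly dense in `C(V)`; since
`μ(V_0) = 0`, in `L²` they can be approximated by functions of finite energy vanishing on `V_0`,
where the boundary terms vanish as well.
-/

noncomputable section

/-! ### Subgradients and resolvents -/

section Subgradient

variable {H : Type*} [NormedAddCommGroup H] [InnerProductSpace ℝ H] {W : H → ℝ≥0∞}

theorem mem_subgradient_iff {u f : H} :
    f ∈ subgradient W u ↔ u ∈ effDomain W ∧
      ∀ v ∈ effDomain W, (W u).toReal + inner ℝ f (v - u) ≤ (W v).toReal := by
  have coe_iff : ∀ v, u ∈ effDomain W → v ∈ effDomain W →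
      ((W u : EReal) + ((inner ℝ f (v - u) : ℝ) : EReal) ≤ (W v : EReal) ↔
        (W u).toReal + inner ℝ f (v - u) ≤ (W v).toReal) := by
    intro v hu hv
    rw [← EReal.coe_ennreal_toReal hu.ne, ← EReal.coe_ennreal_toReal hv.ne, ← EReal.coe_add,
      EReal.coe_le_coe_iff]
  constructor
  · rintro ⟨hu, h⟩
    refine ⟨hu, fun v hv => (coe_iff v hu hv).1 ?_⟩
    simpa only [add_sub_cancel] using h (v - u)
  · rintro ⟨hu, h⟩
    refine ⟨hu, fun v => ?_⟩
    rcases lt_or_ge (W (u + v)) ∞ with hv | hv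
    · simpa only [add_sub_cancel_left] using (coe_iff (u + v) hu hv).2 (h _ hv)
    · rw [top_le_iff.1 hv]
      exact le_top

theorem inner_sub_nonneg_of_mem_subgradient {u v f g : H} (hf : f ∈ subgradient W u)
    (hg : g ∈ subgradient W v) : 0 ≤ inner ℝ (f - g) (u - v) := by
  rw [mem_subgradient_iff] at hf hg
  have hfv := hf.2 v hg.1
  have hgu := hg.2 u hf.1
  rw [← neg_sub u v, inner_neg_right] at hfv
  rw [inner_sub_left]
  linarith

/-- The resolvent relation `y = (1 + l ∂W)⁻¹ x`, for `l > 0`. -/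
def IsProx (W : H → ℝ≥0∞) (l : ℝ) (x y : H) : Prop := l⁻¹ • (x - y) ∈ subgradient W y

/-- `J l` is the resolvent `(1 + l ∂W)⁻¹` for every `l > 0`; these are the implicit Euler steps
for the gradient flow of `W`. -/
def IsResolventFamily (W : H → ℝ≥0∞) (J : ℝ → H → H) : Prop :=
  ∀ l, 0 < l → ∀ x, IsProx W l x (J l x)

namespace IsProx

theorem mem_effDomain {l : ℝ} {x y : H} (h : IsProx W l x y) : y ∈ effDomain W := h.1

theorem norm_sub_le {l : ℝ} (hl : 0 < l) {x y x' y' : H} (h : IsProx W l x y)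
    (h' : IsProx W l x' y') : ‖y - y'‖ ≤ ‖x - x'‖ := by
  have hmono : 0 ≤ inner ℝ ((x - x') - (y - y')) (y - y') := by
    have h0 := inner_sub_nonneg_of_mem_subgradient h h'
    rw [← smul_sub, real_inner_smul_left, sub_sub_sub_comm] at h0
    exact nonneg_of_mul_nonneg_right h0 (inv_pos.2 hl)
  rw [inner_sub_left, real_inner_self_eq_norm_sq] at hmono
  have hcs := real_inner_le_norm (x - x') (y - y')
  by_contra! hc
  nlinarith [norm_nonneg (x - x'), norm_nonneg (y - y')]

theorem add_smul_self {l : ℝ} (hl : 0 < l) {x f : H} (hf : f ∈ subgradient W x) :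
    IsProx W l (x + l • f) x := by
  rwa [IsProx, add_sub_cancel_left, inv_smul_smul₀ hl.ne']

theorem resolvent_identity {l m : ℝ} (hm : 0 < m) {x y : H} (h : IsProx W l x y) :
    IsProx W m ((m / l) • x + (1 - m / l) • y) y := by
  have hsub : (m / l) • x + (1 - m / l) • y - y = m • l⁻¹ • (x - y) := by
    rw [div_eq_mul_inv]
    module
  rwa [IsProx, hsub, inv_smul_smul₀ hm.ne']

theorem toReal_sub_le {l : ℝ} (hl : 0 < l) {x y v : H} (h : IsProx W l x y)
    (hv : v ∈ effDomain W) :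
    l * ((W y).toReal - (W v).toReal) ≤ 1 / 2 * ‖x - v‖ ^ 2 - 1 / 2 * ‖y - v‖ ^ 2 := by
  have hsub := (mem_subgradient_iff.1 h).2 v hv
  rw [real_inner_smul_left] at hsub
  have hexp : ‖x - v‖ ^ 2 = ‖x - y‖ ^ 2 - 2 * inner ℝ (x - y) (v - y) + ‖v - y‖ ^ 2 := by
    rw [← norm_sub_sq_real, sub_sub_sub_cancel_right]
  have hcancel : l * (l⁻¹ * inner ℝ (x - y) (v - y)) = inner ℝ (x - y) (v - y) :=
    mul_inv_cancel_left₀ hl.ne' _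
  rw [hexp, norm_sub_rev y v]
  nlinarith [sq_nonneg ‖x - y‖]

theorem toReal_add_le {l : ℝ} {x y : H} (h : IsProx W l x y) (hx : x ∈ effDomain W) :
    (W y).toReal + l⁻¹ * ‖y - x‖ ^ 2 ≤ (W x).toReal := by
  have hsub := (mem_subgradient_iff.1 h).2 x hx
  rwa [real_inner_smul_left, real_inner_self_eq_norm_sq, norm_sub_rev] at hsub

end IsProx

theorem ConvexEnergy.convexOn {E : Type*} [AddCommGroup E] [Module ℝ E] {W : E → ℝ≥0∞}
    (hc : ConvexEnergy W) : ConvexOn ℝ (effDomain W) fun v => (W v).toReal := by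
  have hfin : ∀ u ∈ effDomain W, ∀ v ∈ effDomain W, ∀ a b : ℝ,
      ENNReal.ofReal a * W u < ∞ ∧ ENNReal.ofReal b * W v < ∞ := fun u hu v hv a b =>
    ⟨ENNReal.mul_lt_top ENNReal.ofReal_lt_top hu, ENNReal.mul_lt_top ENNReal.ofReal_lt_top hv⟩
  refine ⟨fun u hu v hv a b ha hb hab => ?_, fun u hu v hv a b ha hb hab => ?_⟩
  · exact (hc u v a b ha hb hab).trans_lt (ENNReal.add_lt_top.2 (hfin u hu v hv a b))
  · obtain ⟨hau, hbv⟩ := hfin u hu v hv a b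
    have h := ENNReal.toReal_mono (ENNReal.add_lt_top.2 ⟨hau, hbv⟩).ne (hc u v a b ha hb hab)
    rwa [ENNReal.toReal_add hau.ne hbv.ne, ENNReal.toReal_mul, ENNReal.toReal_mul,
      ENNReal.toReal_ofReal ha, ENNReal.toReal_ofReal hb] at h

theorem toReal_le_of_tendsto {E ι : Type*} [TopologicalSpace E] {W : E → ℝ≥0∞}
    (hW : LowerSemicontinuous W) {F : Filter ι} [NeBot F] {x : ι → E} {y : E} {c : ι → ℝ} {d : ℝ}
    (hx : Tendsto x F (𝓝 y)) (hc : Tendsto c F (𝓝 d))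
    (h : ∀ᶠ i in F, x i ∈ effDomain W ∧ (W (x i)).toReal ≤ c i) :
    y ∈ effDomain W ∧ (W y).toReal ≤ d := by
  have hWy : W y ≤ ENNReal.ofReal d :=
    hW.isClosed_epigraph.mem_of_tendsto
      (hx.prodMk_nhds ((ENNReal.continuous_ofReal.tendsto d).comp hc))
      (h.mono fun i hi => (ENNReal.le_ofReal_iff_toReal_le hi.1.ne
        (ENNReal.toReal_nonneg.trans hi.2)).2 hi.2)
  have hd : 0 ≤ d := ge_of_tendsto hc (h.mono fun i hi => ENNReal.toReal_nonneg.trans hi.2)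
  exact ⟨hWy.trans_lt ENNReal.ofReal_lt_top, ENNReal.toReal_le_of_le_ofReal hd hWy⟩

/-- The functional whose minimiser is `(1 + l ∂W)⁻¹ x`; it is meant on the effective domain of `W`
only, as `toReal` sends the value `∞` to `0`. -/
def proxFunctional (W : H → ℝ≥0∞) (l : ℝ) (x v : H) : ℝ :=
  (W v).toReal + (2 * l)⁻¹ * ‖v - x‖ ^ 2

theorem norm_midpoint_sub_sq (u v x : H) :
    ‖(1 / 2 : ℝ) • u + (1 / 2 : ℝ) • v - x‖ ^ 2 =
      1 / 2 * ‖u - x‖ ^ 2 + 1 / 2 * ‖v - x‖ ^ 2 - 1 / 4 * ‖u - v‖ ^ 2 := by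
  have hmid : (1 / 2 : ℝ) • u + (1 / 2 : ℝ) • v - x = (1 / 2 : ℝ) • ((u - x) + (v - x)) := by
    module
  rw [hmid, norm_smul, mul_pow, norm_add_sq_real, ← sub_sub_sub_cancel_right u v x,
    norm_sub_sq_real (u - x), Real.norm_of_nonneg (by norm_num)]
  ring

theorem ConvexEnergy.norm_sub_sq_le_of_proxFunctional_le (hc : ConvexEnergy W) {l : ℝ}
    (hl : 0 < l) {x u v : H} (hu : u ∈ effDomain W) (hv : v ∈ effDomain W) {m ε : ℝ}
    (hm : ∀ w ∈ effDomain W, m ≤ proxFunctional W l x w)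
    (hmu : proxFunctional W l x u ≤ m + ε) (hmv : proxFunctional W l x v ≤ m + ε) :
    ‖u - v‖ ^ 2 ≤ 8 * l * ε := by
  have hhalf : (0 : ℝ) ≤ 1 / 2 := by norm_num
  have hmid := hm _ (hc.convexOn.1 hu hv hhalf hhalf (by norm_num))
  have hconv := hc.convexOn.2 hu hv hhalf hhalf (by norm_num)
  simp only [proxFunctional, norm_midpoint_sub_sq, smul_eq_mul] at hmid hmu hmv hconv
  have hquarter : (2 * l)⁻¹ * (1 / 4 * ‖u - v‖ ^ 2) ≤ ε := by linarith
  have hrw : (2 * l)⁻¹ * (1 / 4 * ‖u - v‖ ^ 2) = ‖u - v‖ ^ 2 / (8 * l) := by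
    field_simp
    ring
  rw [hrw, div_le_iff₀ (by positivity)] at hquarter
  linarith

theorem ConvexEnergy.exists_forall_proxFunctional_le [CompleteSpace H] (hc : ConvexEnergy W)
    (hW : LowerSemicontinuous W) (hne : (effDomain W).Nonempty) {l : ℝ} (hl : 0 < l) (x : H) :
    ∃ y ∈ effDomain W, ∀ v ∈ effDomain W, proxFunctional W l x y ≤ proxFunctional W l x v := by
  set m := sInf (proxFunctional W l x '' effDomain W)
  have hbdd : BddBelow (proxFunctional W l x '' effDomain W) := by
    refine ⟨0, forall_mem_image.2 fun v _ => ?_⟩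
    have := ENNReal.toReal_nonneg (a := W v)
    rw [proxFunctional]
    positivity
  have hm : ∀ v ∈ effDomain W, m ≤ proxFunctional W l x v := fun v hv =>
    csInf_le hbdd (mem_image_of_mem _ hv)
  have hmin : ∀ n : ℕ, ∃ v ∈ effDomain W, proxFunctional W l x v ≤ m + 1 / ((n : ℝ) + 1) := by
    intro n
    obtain ⟨_, ⟨v, hv, rfl⟩, h⟩ :=
      Real.lt_sInf_add_pos (hne.image _) (Nat.one_div_pos_of_nat (n := n))
    exact ⟨v, hv, h.le⟩
  choose v hv hvm using hmin
  have hlim : Tendsto (fun n : ℕ => 1 / ((n : ℝ) + 1)) atTop (𝓝 0) :=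
    tendsto_one_div_add_atTop_nhds_zero_nat
  have hcauchy : CauchySeq v := by
    refine cauchySeq_of_le_tendsto_0 (fun k : ℕ => √(8 * l * (1 / ((k : ℝ) + 1)))) ?_ ?_
    · intro i j k hki hkj
      have hle : ∀ n, k ≤ n → proxFunctional W l x (v n) ≤ m + 1 / ((k : ℝ) + 1) := fun n hn =>
        (hvm n).trans (by gcongr)
      rw [dist_eq_norm]
      exact Real.le_sqrt_of_sq_le
        (hc.norm_sub_sq_le_of_proxFunctional_le hl (hv i) (hv j) hm (hle i hki) (hle j hkj))
    · simpa only [mul_zero, Real.sqrt_zero] using (hlim.const_mul (8 * l)).sqrt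
  obtain ⟨y, hy⟩ := cauchySeq_tendsto_of_complete hcauchy
  obtain ⟨hyW, hym⟩ := toReal_le_of_tendsto hW hy
    ((hlim.const_add m).sub ((((hy.sub_const x).norm).pow 2).const_mul (2 * l)⁻¹))
    (Eventually.of_forall fun n => ⟨hv n, le_sub_iff_add_le.2 (hvm n)⟩)
  refine ⟨y, hyW, fun w hw => le_trans ?_ (hm w hw)⟩
  rw [proxFunctional]
  linarith

theorem ConvexEnergy.isProx_of_forall_proxFunctional_le (hc : ConvexEnergy W) {l : ℝ}
    (hl : 0 < l) {x y : H} (hy : y ∈ effDomain W)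
    (hmin : ∀ v ∈ effDomain W, proxFunctional W l x y ≤ proxFunctional W l x v) :
    IsProx W l x y := by
  refine mem_subgradient_iff.2 ⟨hy, fun v hv => ?_⟩
  have hsegment : ∀ s : ℝ, 0 < s → s ≤ 1 →
      (W y).toReal - (W v).toReal ≤
        l⁻¹ * inner ℝ (y - x) (v - y) + s * ((2 * l)⁻¹ * ‖v - y‖ ^ 2) := by
    intro s hs0 hs1
    have hmem := hc.convexOn.1 hy hv (sub_nonneg.2 hs1) hs0.le (sub_add_cancel 1 s)
    have hconv := hc.convexOn.2 hy hv (sub_nonneg.2 hs1) hs0.le (sub_add_cancel 1 s)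
    have hle := hmin _ hmem
    have hshift : (1 - s) • y + s • v - x = (y - x) + s • (v - y) := by module
    simp only [proxFunctional, hshift, norm_add_sq_real, norm_smul, inner_smul_right, mul_pow,
      Real.norm_of_nonneg hs0.le, smul_eq_mul] at hle hconv
    have hlin : (2 * l)⁻¹ * (2 * (s * inner ℝ (y - x) (v - y))) =
        s * (l⁻¹ * inner ℝ (y - x) (v - y)) := by field_simp
    refine le_of_mul_le_mul_left ?_ hs0
    nlinarith
  have hlim : Tendsto (fun s : ℝ => l⁻¹ * inner ℝ (y - x) (v - y)
      + s * ((2 * l)⁻¹ * ‖v - y‖ ^ 2)) (𝓝[>] 0) (𝓝 (l⁻¹ * inner ℝ (y - x) (v - y))) :=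
    (Continuous.tendsto' (by fun_prop) 0 _ (by ring)).mono_left nhdsWithin_le_nhds
  have hle : (W y).toReal - (W v).toReal ≤ l⁻¹ * inner ℝ (y - x) (v - y) :=
    ge_of_tendsto hlim (by
      filter_upwards [Ioo_mem_nhdsGT one_pos] with s hs using hsegment s hs.1 hs.2.le)
  rw [real_inner_smul_left, ← neg_sub y x, inner_neg_left]
  linarith

theorem ConvexEnergy.exists_isResolventFamily [CompleteSpace H] (hc : ConvexEnergy W)
    (hW : LowerSemicontinuous W) (hne : (effDomain W).Nonempty) :
    ∃ J, IsResolventFamily W J := by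
  have hprox : ∀ l x, ∃ y, 0 < l → IsProx W l x y := by
    intro l x
    rcases lt_or_ge 0 l with hl | hl
    · obtain ⟨y, hy, hmin⟩ := hc.exists_forall_proxFunctional_le hW hne hl x
      exact ⟨y, fun _ => hc.isProx_of_forall_proxFunctional_le hl hy hmin⟩
    · exact ⟨x, fun hl' => absurd hl' hl.not_gt⟩
  choose J hJ using hprox
  exact ⟨J, fun l hl x => hJ l x hl⟩

end Subgradient

/-! ### The implicit Euler scheme -/

section Euler

variable {H : Type*} [NormedAddCommGroup H] [InnerProductSpace ℝ H] {W : H → ℝ≥0∞}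
  {J : ℝ → H → H}

namespace IsResolventFamily

theorem norm_iterate_sub_le (hJ : IsResolventFamily W J) {l : ℝ} (hl : 0 < l) (k : ℕ) (x y : H) :
    ‖(J l)^[k] x - (J l)^[k] y‖ ≤ ‖x - y‖ := by
  induction k with
  | zero => rfl
  | succ k ih =>
    rw [Function.iterate_succ_apply', Function.iterate_succ_apply']
    exact ((hJ l hl _).norm_sub_le hl (hJ l hl _)).trans ih

theorem antitone_norm_step (hJ : IsResolventFamily W J) {l : ℝ} (hl : 0 < l) (x : H) :
    Antitone fun k => ‖(J l)^[k + 1] x - (J l)^[k] x‖ :=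
  antitone_nat_of_succ_le fun k => by
    rw [Function.iterate_succ_apply' _ (k + 1), Function.iterate_succ_apply' _ k]
    exact (hJ l hl _).norm_sub_le hl (hJ l hl _)

theorem norm_iterate_add_sub_le (hJ : IsResolventFamily W J) {l : ℝ} (hl : 0 < l) (x : H)
    (i d : ℕ) :
    ‖(J l)^[i + d] x - (J l)^[i] x‖ ≤ d * ‖(J l)^[i + 1] x - (J l)^[i] x‖ := by
  induction d with
  | zero => simp
  | succ d ih =>
    have hstep := hJ.antitone_norm_step hl x (Nat.le_add_right i d)
    have htri := norm_sub_le_norm_sub_add_norm_sub ((J l)^[i + d + 1] x) ((J l)^[i + d] x)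
      ((J l)^[i] x)
    simp only at hstep
    push_cast
    rw [← add_assoc]
    linarith

theorem norm_sub_self_le (hJ : IsResolventFamily W J) {l : ℝ} (hl : 0 < l) {x f : H}
    (hf : f ∈ subgradient W x) : ‖J l x - x‖ ≤ l * ‖f‖ := by
  have h := (hJ l hl x).norm_sub_le hl (IsProx.add_smul_self hl hf)
  rwa [sub_add_cancel_left, norm_neg, norm_smul, Real.norm_of_nonneg hl.le] at h

theorem norm_iterate_sub_self_le (hJ : IsResolventFamily W J) {l : ℝ} (hl : 0 < l) {x f : H}
    (hf : f ∈ subgradient W x) (k : ℕ) : ‖(J l)^[k] x - x‖ ≤ k * l * ‖f‖ := by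
  have h := hJ.norm_iterate_add_sub_le hl x 0 k
  rw [Nat.zero_add] at h
  calc ‖(J l)^[k] x - x‖ ≤ k * ‖J l x - x‖ := h
    _ ≤ k * (l * ‖f‖) := by gcongr; exact hJ.norm_sub_self_le hl hf
    _ = k * l * ‖f‖ := by ring

theorem norm_iterate_succ_sub_iterate_succ_le (hJ : IsResolventFamily W J) {l m : ℝ} (hm : 0 < m)
    (hml : m ≤ l) (x : H) (k j : ℕ) :
    ‖(J l)^[k + 1] x - (J m)^[j + 1] x‖ ≤ m / l * ‖(J l)^[k] x - (J m)^[j] x‖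
      + (1 - m / l) * ‖(J l)^[k + 1] x - (J m)^[j] x‖ := by
  have hl : 0 < l := hm.trans_le hml
  have hratio : 0 ≤ 1 - m / l := sub_nonneg.2 ((div_le_one hl).2 hml)
  rw [Function.iterate_succ_apply', Function.iterate_succ_apply']
  set y := (J l)^[k] x
  set z := (J m)^[j] x
  have hcomb : (m / l) • y + (1 - m / l) • J l y - z =
      (m / l) • (y - z) + (1 - m / l) • (J l y - z) := by module
  calc ‖J l y - J m z‖ ≤ ‖(m / l) • y + (1 - m / l) • J l y - z‖ :=
        ((hJ l hl y).resolvent_identity hm).norm_sub_le hm (hJ m hm z)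
    _ ≤ ‖(m / l) • (y - z)‖ + ‖(1 - m / l) • (J l y - z)‖ := by
        rw [hcomb]
        exact norm_add_le _ _
    _ = _ := by
        rw [norm_smul, norm_smul, Real.norm_of_nonneg (div_pos hm hl).le,
          Real.norm_of_nonneg hratio]

/-- The right-hand side solves the recursion of `norm_iterate_succ_sub_iterate_succ_le` for squared
distances with equality; this is the Crandall–Liggett estimate. -/
theorem norm_iterate_sub_iterate_sq_le (hJ : IsResolventFamily W J) {l m : ℝ} (hm : 0 < m)
    (hml : m ≤ l) {x f : H} (hf : f ∈ subgradient W x) (k j : ℕ) :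
    ‖(J l)^[k] x - (J m)^[j] x‖ ^ 2 ≤
      ‖f‖ ^ 2 * ((k * l - j * m) ^ 2 + j * m * (l - m)) := by
  have hl : 0 < l := hm.trans_le hml
  have : 0 ≤ l - m := sub_nonneg.2 hml
  induction j generalizing k with
  | zero =>
    calc ‖(J l)^[k] x - x‖ ^ 2 ≤ (k * l * ‖f‖) ^ 2 := by
          gcongr
          exact hJ.norm_iterate_sub_self_le hl hf k
      _ = _ := by push_cast; ring
  | succ j ih =>
    rcases k with _ | k
    · calc ‖x - (J m)^[j + 1] x‖ ^ 2 ≤ (((j + 1 : ℕ) : ℝ) * m * ‖f‖) ^ 2 := by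
            rw [norm_sub_rev]
            gcongr
            exact hJ.norm_iterate_sub_self_le hm hf (j + 1)
        _ ≤ (((j + 1 : ℕ) : ℝ) * m * ‖f‖) ^ 2
            + ‖f‖ ^ 2 * (((j + 1 : ℕ) : ℝ) * m * (l - m)) :=
            le_add_of_nonneg_right (by positivity)
        _ = _ := by push_cast; ring
    · have hrec := hJ.norm_iterate_succ_sub_iterate_succ_le hm hml x k j
      obtain ⟨r, hr⟩ : ∃ r, m / l = r := ⟨_, rfl⟩
      have hr0 : 0 ≤ r := hr ▸ (div_pos hm hl).le
      have hr1 : 0 ≤ 1 - r := sub_nonneg.2 (hr ▸ (div_le_one hl).2 hml)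
      rw [hr] at hrec
      set a := ‖(J l)^[k] x - (J m)^[j] x‖
      set b := ‖(J l)^[k + 1] x - (J m)^[j] x‖
      calc _ ≤ (r * a + (1 - r) * b) ^ 2 := by gcongr
        _ ≤ r * a ^ 2 + (1 - r) * b ^ 2 := by
          nlinarith [mul_nonneg (mul_nonneg hr0 hr1) (sq_nonneg (a - b))]
        _ ≤ r * (‖f‖ ^ 2 * ((k * l - j * m) ^ 2 + j * m * (l - m))) + (1 - r) *
            (‖f‖ ^ 2 * ((((k + 1 : ℕ) : ℝ) * l - j * m) ^ 2 + j * m * (l - m))) := by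
          gcongr
          exacts [ih k, ih (k + 1)]
        _ = _ := by
          rw [(div_eq_iff hl.ne').1 hr]
          push_cast
          ring

theorem iterate_mem_effDomain (hJ : IsResolventFamily W J) {l : ℝ} (hl : 0 < l) (x : H) {k : ℕ}
    (hk : k ≠ 0) : (J l)^[k] x ∈ effDomain W := by
  obtain ⟨k, rfl⟩ := Nat.exists_eq_succ_of_ne_zero hk
  rw [Function.iterate_succ_apply']
  exact (hJ l hl _).mem_effDomain

theorem toReal_iterate_succ_add_le (hJ : IsResolventFamily W J) {l : ℝ} (hl : 0 < l) {x : H}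
    {k : ℕ} (hk : (J l)^[k] x ∈ effDomain W) :
    (W ((J l)^[k + 1] x)).toReal + l⁻¹ * ‖(J l)^[k + 1] x - (J l)^[k] x‖ ^ 2 ≤
      (W ((J l)^[k] x)).toReal := by
  rw [Function.iterate_succ_apply']
  exact (hJ l hl _).toReal_add_le hk

theorem mul_toReal_iterate_sub_le (hJ : IsResolventFamily W J) {l : ℝ} (hl : 0 < l) (x : H)
    {v : H} (hv : v ∈ effDomain W) (k : ℕ) :
    k * l * ((W ((J l)^[k] x)).toReal - (W v).toReal) ≤
      1 / 2 * ‖x - v‖ ^ 2 - 1 / 2 * ‖(J l)^[k] x - v‖ ^ 2 := by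
  induction k with
  | zero => simp
  | succ k ih =>
    have hlast := (hJ l hl ((J l)^[k] x)).toReal_sub_le hl hv
    rw [← Function.iterate_succ_apply' (J l)] at hlast
    have hdecr : k * l * (W ((J l)^[k + 1] x)).toReal ≤ k * l * (W ((J l)^[k] x)).toReal := by
      rcases eq_or_ne k 0 with rfl | hk
      · simp
      · have h := hJ.toReal_iterate_succ_add_le hl (hJ.iterate_mem_effDomain hl x hk)
        exact mul_le_mul_of_nonneg_left ((le_add_of_nonneg_right (by positivity)).trans h)
          (by positivity)
    push_cast
    linarith

theorem mul_norm_step_sq_add_toReal_le (hJ : IsResolventFamily W J) {l : ℝ} (hl : 0 < l) {x : H}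
    (hx : x ∈ effDomain W) (k : ℕ) :
    k * l⁻¹ * ‖(J l)^[k + 1] x - (J l)^[k] x‖ ^ 2 + (W ((J l)^[k] x)).toReal ≤
      (W x).toReal := by
  induction k with
  | zero => simp
  | succ k ih =>
    have hk : (J l)^[k] x ∈ effDomain W := by
      rcases eq_or_ne k 0 with rfl | hk
      exacts [hx, hJ.iterate_mem_effDomain hl x hk]
    have henergy := hJ.toReal_iterate_succ_add_le hl hk
    have hstep : ((k + 1 : ℕ) : ℝ) * l⁻¹ * ‖(J l)^[k + 1 + 1] x - (J l)^[k + 1] x‖ ^ 2 ≤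
        ((k + 1 : ℕ) : ℝ) * l⁻¹ * ‖(J l)^[k + 1] x - (J l)^[k] x‖ ^ 2 := by
      gcongr
      exact hJ.antitone_norm_step hl x k.le_succ
    push_cast at *
    linarith

theorem toReal_iterate_le (hJ : IsResolventFamily W J) {l : ℝ} (hl : 0 < l) (x : H) {v : H}
    (hv : v ∈ effDomain W) {k : ℕ} {T : ℝ} (hT : 0 < T) (hkT : T ≤ k * l) :
    (W ((J l)^[k] x)).toReal ≤ (W v).toReal + ‖x - v‖ ^ 2 / (2 * T) := by
  set w := (W ((J l)^[k] x)).toReal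
  rcases le_total w (W v).toReal with h | h
  · exact h.trans (le_add_of_nonneg_right (by positivity))
  · have hEVI := hJ.mul_toReal_iterate_sub_le hl x hv k
    have hmul := mul_le_mul_of_nonneg_right hkT (sub_nonneg.2 h)
    rw [← sub_le_iff_le_add', le_div_iff₀ (by positivity)]
    nlinarith [sq_nonneg ‖(J l)^[k] x - v‖]

/-- The regularising effect: after time `2 * T` the speed of the scheme is bounded in terms of
`T` only, since it decreases and its square is summable against the dissipated energy. -/
theorem norm_step_le (hJ : IsResolventFamily W J) {l : ℝ} (hl : 0 < l)
    (x : H) {v : H} (hv : v ∈ effDomain W) {k i : ℕ} (hki : 2 * k ≤ i) {T : ℝ} (hT : 0 < T)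
    (hkT : T ≤ k * l) :
    ‖(J l)^[i + 1] x - (J l)^[i] x‖ ≤
      l * √(((W v).toReal + ‖x - v‖ ^ 2 / (2 * T)) / T) := by
  set D := ‖(J l)^[2 * k + 1] x - (J l)^[2 * k] x‖
  set w := (W ((J l)^[k] x)).toReal
  have hk : k ≠ 0 := by
    rintro rfl
    rw [Nat.cast_zero, zero_mul] at hkT
    exact hT.not_ge hkT
  have hdissip : k * l⁻¹ * D ^ 2 ≤ w := by
    have h := hJ.mul_norm_step_sq_add_toReal_le hl (hJ.iterate_mem_effDomain hl x hk) k
    rw [← Function.iterate_add_apply, ← Function.iterate_add_apply,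
      show k + 1 + k = 2 * k + 1 by ring, show k + k = 2 * k by ring] at h
    exact (le_add_of_nonneg_right ENNReal.toReal_nonneg).trans h
  have hD : (D / l) ^ 2 ≤ w / T := by
    rw [le_div_iff₀ hT]
    calc (D / l) ^ 2 * T ≤ (D / l) ^ 2 * (k * l) := by gcongr
      _ = k * l⁻¹ * D ^ 2 := by field_simp
      _ ≤ w := hdissip
  rw [mul_comm, ← div_le_iff₀ hl]
  refine Real.le_sqrt_of_sq_le ?_
  calc (‖(J l)^[i + 1] x - (J l)^[i] x‖ / l) ^ 2 ≤ (D / l) ^ 2 := by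
        gcongr
        exact hJ.antitone_norm_step hl x hki
    _ ≤ w / T := hD
    _ ≤ _ := by
        gcongr
        exact hJ.toReal_iterate_le hl x hv hT hkT

theorem closure_effDomain_subset (hJ : IsResolventFamily W J) :
    closure (effDomain W) ⊆ closure {y | (subgradient W y).Nonempty} := by
  refine closure_minimal (fun z hz => ?_) isClosed_closure
  have hlim : Tendsto (fun l : ℝ => √(l * (W z).toReal)) (𝓝[>] 0) (𝓝 0) :=
    (Continuous.tendsto' (by fun_prop) 0 _ (by simp)).mono_left nhdsWithin_le_nhds
  refine mem_closure_of_tendsto (tendsto_iff_norm_sub_tendsto_zero.2 (squeeze_zero'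
    (Eventually.of_forall fun l => norm_nonneg (J l z - z)) ?_ hlim)) ?_
  · filter_upwards [self_mem_nhdsWithin] with l (hl : 0 < l)
    refine Real.le_sqrt_of_sq_le ((inv_mul_le_iff₀ hl).1 ?_)
    exact (le_add_of_nonneg_left ENNReal.toReal_nonneg).trans ((hJ l hl z).toReal_add_le hz)
  · filter_upwards [self_mem_nhdsWithin] with l hl using ⟨_, hJ l hl z⟩

end IsResolventFamily

end Euler

section EulerLimit

theorem floor_div_mul_le {t h : ℝ} (ht : 0 ≤ t) (hh : 0 < h) : ⌊t / h⌋₊ * h ≤ t :=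
  (le_div_iff₀ hh).1 (Nat.floor_le (by positivity))

theorem lt_floor_div_mul_add (t : ℝ) {h : ℝ} (hh : 0 < h) : t < ⌊t / h⌋₊ * h + h := by
  rw [← add_one_mul, ← div_lt_iff₀ hh]
  exact Nat.lt_floor_add_one _

theorem tendsto_floor_div_mul {t : ℝ} (ht : 0 ≤ t) :
    Tendsto (fun h : ℝ => ⌊t / h⌋₊ * h) (𝓝[>] 0) (𝓝 t) := by
  have hlower : Tendsto (fun h : ℝ => t - h) (𝓝[>] 0) (𝓝 t) :=
    (Continuous.tendsto' (by fun_prop) 0 _ (by simp)).mono_left nhdsWithin_le_nhds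
  refine tendsto_of_tendsto_of_tendsto_of_le_of_le' hlower tendsto_const_nhds ?_ ?_
  · filter_upwards [self_mem_nhdsWithin] with h hh
    exact sub_le_iff_le_add.2 (lt_floor_div_mul_add t hh).le
  · filter_upwards [self_mem_nhdsWithin] with h hh using floor_div_mul_le ht hh

/-- The value at time `t` of the implicit Euler scheme with step `h > 0` started at `x`. -/
def euler {E : Type*} (J : ℝ → E → E) (h t : ℝ) (x : E) : E := (J h)^[⌊t / h⌋₊] x

theorem euler_eq_iterate_euler {E : Type*} (J : ℝ → E → E) {h s t : ℝ} (hh : 0 < h) (hst : s ≤ t)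
    (x : E) : euler J h t x = (J h)^[⌊t / h⌋₊ - ⌊s / h⌋₊] (euler J h s x) := by
  rw [euler, euler, ← Function.iterate_add_apply, Nat.sub_add_cancel (by gcongr)]

variable {H : Type*} [NormedAddCommGroup H] [InnerProductSpace ℝ H] {W : H → ℝ≥0∞}
  {J : ℝ → H → H}

/-- The gradient flow from `x` at time `t`, as the limit of the implicit Euler schemes when the step
tends to `0`; it is meant for `0 ≤ t` and `x` in the closure of the effective domain, where the
limit exists. -/
def eulerLimit (J : ℝ → H → H) (t : ℝ) (x : H) : H := limUnder (𝓝[>] 0) fun h => euler J h t x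

namespace IsResolventFamily

theorem norm_euler_sub_le (hJ : IsResolventFamily W J) {h : ℝ} (hh : 0 < h) (t : ℝ) (x y : H) :
    ‖euler J h t x - euler J h t y‖ ≤ ‖x - y‖ :=
  hJ.norm_iterate_sub_le hh _ x y

theorem norm_euler_sub_euler_le (hJ : IsResolventFamily W J) {x f : H}
    (hf : f ∈ subgradient W x) {t h h' : ℝ} (ht : 0 ≤ t) (hh' : 0 < h') (hle : h' ≤ h) :
    ‖euler J h t x - euler J h' t x‖ ≤ √(‖f‖ ^ 2 * (h ^ 2 + t * h)) := by
  have hh : 0 < h := hh'.trans_le hle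
  refine Real.le_sqrt_of_sq_le
    ((hJ.norm_iterate_sub_iterate_sq_le hh' hle hf ⌊t / h⌋₊ ⌊t / h'⌋₊).trans ?_)
  have hgap : (⌊t / h⌋₊ * h - ⌊t / h'⌋₊ * h') ^ 2 ≤ h ^ 2 :=
    sq_le_sq' (by linarith [floor_div_mul_le ht hh', lt_floor_div_mul_add t hh])
      (by linarith [floor_div_mul_le ht hh, lt_floor_div_mul_add t hh'])
  have hstep : ⌊t / h'⌋₊ * h' * (h - h') ≤ t * h :=
    mul_le_mul (floor_div_mul_le ht hh') (sub_le_self _ hh'.le) (sub_nonneg.2 hle) ht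
  gcongr

theorem cauchy_map_euler (hJ : IsResolventFamily W J) {x : H} (hx : x ∈ closure (effDomain W))
    {t : ℝ} (ht : 0 ≤ t) : Cauchy (map (fun h => euler J h t x) (𝓝[>] 0)) := by
  refine Metric.cauchy_iff.2 ⟨inferInstance, fun ε hε => ?_⟩
  obtain ⟨y, ⟨f, hf⟩, hxy⟩ :=
    Metric.mem_closure_iff.1 (hJ.closure_effDomain_subset hx) (ε / 3) (by positivity)
  have hlim : Tendsto (fun h : ℝ => √(‖f‖ ^ 2 * (h ^ 2 + t * h))) (𝓝[>] 0) (𝓝 0) :=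
    (Continuous.tendsto' (by fun_prop) 0 _ (by simp)).mono_left nhdsWithin_le_nhds
  have hsmall : {h | 0 < h ∧ √(‖f‖ ^ 2 * (h ^ 2 + t * h)) < ε / 3} ∈ 𝓝[>] (0 : ℝ) :=
    inter_mem self_mem_nhdsWithin (hlim.eventually (gt_mem_nhds (by positivity)))
  have hclose : ∀ h, 0 < h → dist (euler J h t x) (euler J h t y) < ε / 3 := fun h hh =>
    (dist_eq_norm _ _).trans_lt
      ((hJ.norm_euler_sub_le hh t x y).trans_lt (by rwa [← dist_eq_norm]))
  refine ⟨_, image_mem_map hsmall, ?_⟩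
  rintro _ ⟨h, ⟨hh, hhε⟩, rfl⟩ _ ⟨h', ⟨hh', hhε'⟩, rfl⟩
  have hy : dist (euler J h t y) (euler J h' t y) < ε / 3 := by
    rw [dist_eq_norm]
    rcases le_total h' h with hle | hle
    · exact (hJ.norm_euler_sub_euler_le hf ht hh' hle).trans_lt hhε
    · rw [norm_sub_rev]
      exact (hJ.norm_euler_sub_euler_le hf ht hh hle).trans_lt hhε'
  have htri := dist_triangle4 (euler J h t x) (euler J h t y) (euler J h' t y) (euler J h' t x)
  have hx' := hclose h' hh'
  rw [dist_comm] at hx'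
  linarith [hclose h hh]

theorem tendsto_eulerLimit [CompleteSpace H] (hJ : IsResolventFamily W J) {x : H}
    (hx : x ∈ closure (effDomain W)) {t : ℝ} (ht : 0 ≤ t) :
    Tendsto (fun h => euler J h t x) (𝓝[>] 0) (𝓝 (eulerLimit J t x)) :=
  tendsto_nhds_limUnder (cauchy_map_iff_exists_tendsto.1 (hJ.cauchy_map_euler hx ht))

theorem norm_eulerLimit_sub_self_le [CompleteSpace H] (hJ : IsResolventFamily W J) {x y f : H}
    (hx : x ∈ closure (effDomain W)) (hf : f ∈ subgradient W y) {t : ℝ} (ht : 0 ≤ t) :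
    ‖eulerLimit J t x - x‖ ≤ 2 * ‖x - y‖ + t * ‖f‖ := by
  refine le_of_tendsto ((hJ.tendsto_eulerLimit hx ht).sub_const x).norm ?_
  filter_upwards [self_mem_nhdsWithin] with h (hh : 0 < h)
  have hxy := hJ.norm_euler_sub_le hh t x y
  have hy : ‖euler J h t y - y‖ ≤ t * ‖f‖ :=
    (hJ.norm_iterate_sub_self_le hh hf _).trans (by gcongr; exact floor_div_mul_le ht hh)
  calc ‖euler J h t x - x‖
      ≤ ‖euler J h t x - euler J h t y‖ + ‖euler J h t y - y‖ + ‖x - y‖ := by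
        rw [← dist_eq_norm, ← dist_eq_norm, ← dist_eq_norm, ← dist_eq_norm, dist_comm x y]
        exact dist_triangle4 _ _ _ _
    _ ≤ 2 * ‖x - y‖ + t * ‖f‖ := by linarith

theorem tendsto_eulerLimit_zero [CompleteSpace H] (hJ : IsResolventFamily W J) {x : H}
    (hx : x ∈ closure (effDomain W)) :
    Tendsto (fun t => eulerLimit J t x) (𝓝[≥] 0) (𝓝 x) := by
  refine Metric.tendsto_nhds.2 fun ε hε => ?_
  obtain ⟨y, ⟨f, hf⟩, hxy⟩ :=
    Metric.mem_closure_iff.1 (hJ.closure_effDomain_subset hx) (ε / 2) (by positivity)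
  rw [dist_eq_norm] at hxy
  have hlim : Tendsto (fun t : ℝ => 2 * ‖x - y‖ + t * ‖f‖) (𝓝[≥] 0) (𝓝 (2 * ‖x - y‖)) :=
    (Continuous.tendsto' (by fun_prop) 0 _ (by simp)).mono_left nhdsWithin_le_nhds
  filter_upwards [self_mem_nhdsWithin, hlim.eventually (gt_mem_nhds (by linarith : _ < ε))]
    with t ht htε
  rw [dist_eq_norm]
  exact (hJ.norm_eulerLimit_sub_self_le hx hf ht).trans_lt htε

theorem lipschitzOnWith_eulerLimit [CompleteSpace H] (hJ : IsResolventFamily W J) {x v : H}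
    (hx : x ∈ closure (effDomain W)) (hv : v ∈ effDomain W) {T : ℝ} (hT : 0 < T) :
    LipschitzOnWith (√(((W v).toReal + ‖x - v‖ ^ 2 / (2 * T)) / T)).toNNReal
      (fun t => eulerLimit J t x) (Ici (4 * T)) := by
  rw [lipschitzOnWith_iff_norm_sub_le]
  set C := √(((W v).toReal + ‖x - v‖ ^ 2 / (2 * T)) / T)
  rw [Real.coe_toNNReal C (Real.sqrt_nonneg _)]
  intro t ht s hs
  wlog hst : s ≤ t generalizing s t
  · rw [norm_sub_rev, norm_sub_rev t]
    exact this hs ht (le_of_not_ge hst)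
  have hs0 : 0 ≤ s := (by positivity : 0 ≤ 4 * T).trans hs
  have ht0 : 0 ≤ t := hs0.trans hst
  rw [Real.norm_of_nonneg (sub_nonneg.2 hst)]
  refine le_of_tendsto_of_tendsto
    ((hJ.tendsto_eulerLimit hx ht0).sub (hJ.tendsto_eulerLimit hx hs0)).norm
    (((tendsto_floor_div_mul ht0).sub (tendsto_floor_div_mul hs0)).const_mul C) ?_
  filter_upwards [Ioo_mem_nhdsGT hT] with h ⟨hh, hhT⟩
  have hfloor : ⌊s / h⌋₊ ≤ ⌊t / h⌋₊ := by gcongr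
  have hhalf : 2 * ⌊2 * T / h⌋₊ ≤ ⌊s / h⌋₊ := by
    refine Nat.le_floor ((le_div_iff₀ hh).2 ?_)
    push_cast
    linarith [floor_div_mul_le (by positivity : 0 ≤ 2 * T) hh, mem_Ici.1 hs]
  have hstep := hJ.norm_step_le hh x hv hhalf hT
    (by linarith [lt_floor_div_mul_add (2 * T) hh])
  have hsum := hJ.norm_iterate_add_sub_le hh x ⌊s / h⌋₊ (⌊t / h⌋₊ - ⌊s / h⌋₊)
  rw [Nat.add_sub_cancel' hfloor, Nat.cast_sub hfloor] at hsum
  calc ‖euler J h t x - euler J h s x‖ ≤ _ := hsum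
    _ ≤ (⌊t / h⌋₊ - ⌊s / h⌋₊) * (h * C) := by
      refine mul_le_mul_of_nonneg_left hstep (sub_nonneg.2 ?_)
      exact_mod_cast hfloor
    _ = C * (⌊t / h⌋₊ * h - ⌊s / h⌋₊ * h) := by ring

end IsResolventFamily

/-- The evolution variational inequality, in integrated form; it characterises the gradient flow of
a convex `W` and is stable under limits. -/
def IsEVISolution (W : H → ℝ≥0∞) (u : ℝ → H) : Prop :=
  ∀ s t, 0 ≤ s → s < t → ∀ v ∈ effDomain W, u t ∈ effDomain W ∧
    (W (u t)).toReal ≤ (W v).toReal + (1 / 2 * ‖u s - v‖ ^ 2 - 1 / 2 * ‖u t - v‖ ^ 2) / (t - s)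

theorem IsResolventFamily.isEVISolution_eulerLimit [CompleteSpace H] (hJ : IsResolventFamily W J)
    (hW : LowerSemicontinuous W) {x : H} (hx : x ∈ closure (effDomain W)) :
    IsEVISolution W fun t => eulerLimit J t x := by
  intro s t hs hst v hv
  have hlim : ∀ r, 0 ≤ r → Tendsto (fun h => 1 / 2 * ‖euler J h r x - v‖ ^ 2) (𝓝[>] 0)
      (𝓝 (1 / 2 * ‖eulerLimit J r x - v‖ ^ 2)) := fun r hr =>
    ((((hJ.tendsto_eulerLimit hx hr).sub_const v).norm).pow 2).const_mul _
  have ht : 0 ≤ t := hs.trans hst.le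
  have htime := (tendsto_floor_div_mul ht).sub (tendsto_floor_div_mul hs)
  refine toReal_le_of_tendsto hW (hJ.tendsto_eulerLimit hx ht)
    ((((hlim s hs).sub (hlim t ht)).div htime (sub_pos.2 hst).ne').const_add _) ?_
  filter_upwards [self_mem_nhdsWithin, htime.eventually (lt_mem_nhds (sub_pos.2 hst))]
    with h (hh : 0 < h) hpos
  have hfloor : ⌊s / h⌋₊ ≤ ⌊t / h⌋₊ := by gcongr
  have hsteps : ((⌊t / h⌋₊ - ⌊s / h⌋₊ : ℕ) : ℝ) * h = ⌊t / h⌋₊ * h - ⌊s / h⌋₊ * h := by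
    rw [Nat.cast_sub hfloor, sub_mul]
  have hEVI := hJ.mul_toReal_iterate_sub_le hh (euler J h s x) hv (⌊t / h⌋₊ - ⌊s / h⌋₊)
  rw [← euler_eq_iterate_euler J hh hst.le, hsteps, mul_comm, ← le_div_iff₀ hpos,
    sub_le_iff_le_add'] at hEVI
  refine ⟨?_, hEVI⟩
  rw [euler_eq_iterate_euler J hh hst.le]
  refine hJ.iterate_mem_effDomain hh _ fun hzero => ?_
  rw [← hsteps, hzero, Nat.cast_zero, zero_mul] at hpos
  exact hpos.false

end EulerLimit

/-! ### Lipschitz curves in a Hilbert space -/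

theorem norm_differenceQuotient_le {E : Type*} [NormedAddCommGroup E] [NormedSpace ℝ E]
    {u : ℝ → E} {C : ℝ≥0} (hu : LipschitzWith C u) (s h : ℝ) :
    ‖h⁻¹ • (u (s + h) - u s)‖ ≤ C := by
  have hdist := hu.norm_sub_le (s + h) s
  rw [add_sub_cancel_left] at hdist
  rw [norm_smul, norm_inv, ← div_eq_inv_mul]
  exact div_le_of_le_mul₀ (norm_nonneg h) C.2 hdist

section LipschitzCurve

variable {H : Type*} [NormedAddCommGroup H] [InnerProductSpace ℝ H] [CompleteSpace H]

theorem exists_forall_tendsto_inner {ι : Type*} (F : Ultrafilter ι) {x : ι → H} {K : ℝ}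
    (hx : ∀ i, ‖x i‖ ≤ K) :
    ∃ y : H, ∀ z : H, Tendsto (fun i => inner ℝ (x i) z) F (𝓝 (inner ℝ y z)) := by
  set φ : ι → WeakDual ℝ H := fun i =>
    StrongDual.toWeakDual (InnerProductSpace.toDual ℝ H (x i))
  have hmem : ∀ i, φ i ∈ WeakDual.toStrongDual ⁻¹' Metric.closedBall (0 : StrongDual ℝ H) K := by
    intro i
    rw [mem_preimage, mem_closedBall_zero_iff]
    exact ((InnerProductSpace.toDual ℝ H).norm_map (x i)).trans_le (hx i)
  obtain ⟨ℓ, -, hℓ⟩ := (WeakDual.isCompact_closedBall (𝕜 := ℝ) (E := H) 0 K).ultrafilter_le_nhds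
    (F.map φ) (le_principal_iff.2 (Eventually.of_forall (f := (F : Filter ι)) hmem))
  refine ⟨(InnerProductSpace.toDual ℝ H).symm (WeakDual.toStrongDual ℓ), fun z => ?_⟩
  rw [InnerProductSpace.toDual_symm_apply]
  exact ((WeakDual.eval_continuous z).tendsto ℓ).comp hℓ

theorem exists_forall_tendsto_inner_setIntegral {α ι : Type*} [MeasurableSpace α] {ν : Measure α}
    [IsFiniteMeasure ν] (F : Ultrafilter ι) {q : ι → α → H} {C : ℝ≥0}
    (hq : ∀ i, AEStronglyMeasurable (q i) ν) (hC : ∀ i s, ‖q i s‖ ≤ C) :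
    ∃ g : α → H, Integrable g ν ∧ ∀ A, MeasurableSet A → ∀ y,
      Tendsto (fun i => inner ℝ y (∫ s in A, q i s ∂ν)) F (𝓝 (inner ℝ y (∫ s in A, g s ∂ν))) := by
  have hqL : ∀ i, MemLp (q i) 2 ν := fun i =>
    MemLp.of_bound (hq i) C (Eventually.of_forall (hC i))
  obtain ⟨g, hg⟩ := exists_forall_tendsto_inner F (x := fun i => (hqL i).toLp (q i)) fun i =>
    Lp.norm_le_of_ae_bound C.2 ((hqL i).coeFn_toLp.mono fun s hs => by rw [hs]; exact hC i s)
  refine ⟨g, (Lp.memLp g).integrable (by norm_num), fun A hA y => ?_⟩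
  have hinner : ∀ f : Lp H 2 ν, inner ℝ f (indicatorConstLp 2 hA (measure_ne_top ν _) y) =
      inner ℝ y (∫ s in A, f s ∂ν) := by
    intro f
    rw [real_inner_comm, L2.inner_indicatorConstLp_eq_inner_setIntegral ℝ]
  have hcoe : ∀ i, ∫ s in A, (hqL i).toLp (q i) s ∂ν = ∫ s in A, q i s ∂ν := fun i =>
    integral_congr_ae (ae_restrict_of_ae (hqL i).coeFn_toLp)
  have h := hg (indicatorConstLp 2 hA (measure_ne_top ν _) y)
  simpa only [hinner, hcoe] using h

theorem tendsto_integral_differenceQuotient {u : ℝ → H} (hu : Continuous u) (a t : ℝ) :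
    Tendsto (fun h => ∫ s in a..t, h⁻¹ • (u (s + h) - u s)) (𝓝[≠] 0) (𝓝 (u t - u a)) := by
  have hint : ∀ a b, IntervalIntegrable u volume a b := fun a b => hu.intervalIntegrable a b
  have hlim : ∀ x, Tendsto (fun h =>
      h⁻¹ • ((∫ s in (0 : ℝ)..x + h, u s) - ∫ s in (0 : ℝ)..x, u s)) (𝓝[≠] 0) (𝓝 (u x)) :=
    fun x => (intervalIntegral.integral_hasDerivAt_right (hint 0 x)
      hu.stronglyMeasurable.stronglyMeasurableAtFilter hu.continuousAt).tendsto_slope_zero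
  refine ((hlim t).sub (hlim a)).congr fun h => ?_
  have hshift : IntervalIntegrable (fun s => u (s + h)) volume a t :=
    (hu.comp (continuous_add_const h)).intervalIntegrable _ _
  rw [intervalIntegral.integral_smul, intervalIntegral.integral_sub hshift (hint a t),
    intervalIntegral.integral_comp_add_right, ← smul_sub,
    ← intervalIntegral.integral_interval_sub_left (hint 0 (t + h)) (hint 0 (a + h)),
    ← intervalIntegral.integral_interval_sub_left (hint 0 t) (hint 0 a), sub_sub_sub_comm]

theorem exists_primitive_of_lipschitzWith {u : ℝ → H} {C : ℝ≥0} (hu : LipschitzWith C u)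
    (a b : ℝ) : ∃ g : ℝ → H, IntegrableOn g (Ioc a b) ∧
      ∀ t ∈ Icc a b, u t - u a = ∫ s in a..t, g s := by
  have hcont := hu.continuous
  obtain ⟨g, hg, hlim⟩ := exists_forall_tendsto_inner_setIntegral
    (ν := volume.restrict (Ioc a b)) (Ultrafilter.of (𝓝[≠] (0 : ℝ)))
    (fun h => Continuous.aestronglyMeasurable (by fun_prop)) fun h s =>
    norm_differenceQuotient_le hu s h
  refine ⟨g, hg, fun t ht => ext_inner_left ℝ fun y => ?_⟩
  have hrestrict : ∀ f : ℝ → H,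
      ∫ s in Ioc a t, f s ∂(volume.restrict (Ioc a b)) = ∫ s in a..t, f s := by
    intro f
    rw [Measure.restrict_restrict measurableSet_Ioc,
      inter_eq_left.2 (Ioc_subset_Ioc_right ht.2), intervalIntegral.integral_of_le ht.1]
  have hq := hlim (Ioc a t) measurableSet_Ioc y
  simp only [hrestrict] at hq
  exact tendsto_nhds_unique (((innerSL ℝ y).continuous.tendsto _).comp
    ((tendsto_integral_differenceQuotient hcont a t).mono_left (Ultrafilter.of_le _))) hq

theorem exists_primitive_of_lipschitzOnWith {u : ℝ → H} {C : ℝ≥0} {a b : ℝ} (hab : a ≤ b)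
    (hu : LipschitzOnWith C u (Icc a b)) : ∃ g : ℝ → H, IntegrableOn g (Ioc a b) ∧
      ∀ t ∈ Icc a b, u t - u a = ∫ s in a..t, g s := by
  obtain ⟨g, hg, hgu⟩ := exists_primitive_of_lipschitzWith
    (hu.to_restrict.comp (LipschitzWith.projIcc hab)) a b
  refine ⟨g, hg, fun t ht => ?_⟩
  rw [← hgu t ht]
  simp only [Function.comp_apply, domRestrict_apply, projIcc_of_mem hab ht, projIcc_left]

theorem ae_hasDerivAt_of_primitive {u g : ℝ → H} {a b : ℝ} (hg : IntegrableOn g (Ioc a b))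
    (hu : ∀ t ∈ Icc a b, u t - u a = ∫ s in a..t, g s) :
    ∀ᵐ t, t ∈ Ioo a b → HasDerivAt u (g t) t := by
  rcases le_or_gt b a with hba | hab
  · rw [Ioo_eq_empty hba.not_gt]
    exact Eventually.of_forall fun t ht => ht.elim
  have hint : IntervalIntegrable g volume a b :=
    (intervalIntegrable_iff_integrableOn_Ioc_of_le hab.le).2 hg
  filter_upwards [hint.ae_hasDerivAt_integral] with t ht htab
  have hder := ht (uIcc_of_le hab.le ▸ Ioo_subset_Icc_self htab) a left_mem_uIcc
  refine (hder.const_add (u a)).congr_of_eventuallyEq ?_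
  filter_upwards [Ioo_mem_nhds htab.1 htab.2] with s hs
  rw [← hu s (Ioo_subset_Icc_self hs), add_sub_cancel]

theorem ae_differentiableAt_of_lipschitzOnWith {u : ℝ → H} {C : ℝ≥0} {a b : ℝ}
    (hu : LipschitzOnWith C u (Icc a b)) : ∀ᵐ t, t ∈ Ioo a b → DifferentiableAt ℝ u t := by
  rcases le_or_gt a b with hab | hab
  · obtain ⟨g, hg, hgu⟩ := exists_primitive_of_lipschitzOnWith hab hu
    filter_upwards [ae_hasDerivAt_of_primitive hg hgu] with t ht htab
    exact (ht htab).differentiableAt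
  · rw [Ioo_eq_empty hab.not_gt]
    exact Eventually.of_forall fun t ht => ht.elim

theorem integral_deriv_of_lipschitzOnWith {u : ℝ → H} {C : ℝ≥0} {a b : ℝ} (hab : a ≤ b)
    (hu : LipschitzOnWith C u (Icc a b)) : ∫ s in a..b, deriv u s = u b - u a := by
  obtain ⟨g, hg, hgu⟩ := exists_primitive_of_lipschitzOnWith hab hu
  rw [hgu b (right_mem_Icc.2 hab)]
  refine intervalIntegral.integral_congr_ae ?_
  filter_upwards [ae_hasDerivAt_of_primitive hg hgu, compl_mem_ae_iff.2 (measure_singleton b)]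
    with t ht htb htab
  rw [uIoc_of_le hab] at htab
  exact (ht ⟨htab.1, htab.2.lt_of_ne htb⟩).deriv

end LipschitzCurve

/-! ### Existence of gradient flows -/

section Existence

variable {H : Type*} [NormedAddCommGroup H] [InnerProductSpace ℝ H] {W : H → ℝ≥0∞}

namespace IsEVISolution

theorem neg_deriv_mem_subgradient {u : ℝ → H} (hu : IsEVISolution W u)
    (hne : (effDomain W).Nonempty) {t : ℝ} (ht : 0 < t) (hd : DifferentiableAt ℝ u t) :
    -deriv u t ∈ subgradient W (u t) := by
  obtain ⟨w, hw⟩ := hne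
  refine mem_subgradient_iff.2 ⟨(hu 0 t le_rfl ht w hw).1, fun v hv => ?_⟩
  have hder : HasDerivAt (fun s => 1 / 2 * ‖u s - v‖ ^ 2) (inner ℝ (u t - v) (deriv u t)) t := by
    simpa using ((hd.hasDerivAt.sub_const v).norm_sq).const_mul (1 / 2 : ℝ)
  have hslope := hder.tendsto_slope.mono_left
    (nhdsWithin_mono t fun s (hs : s ∈ Iio t) => ne_of_lt hs)
  have hle : (W (u t)).toReal - (W v).toReal ≤ -inner ℝ (u t - v) (deriv u t) := by
    refine ge_of_tendsto hslope.neg ?_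
    filter_upwards [self_mem_nhdsWithin, mem_nhdsWithin_of_mem_nhds (Ioi_mem_nhds ht)]
      with s (hst : s < t) (hs0 : 0 < s)
    rw [slope_def_field, ← div_neg, neg_sub, sub_le_iff_le_add']
    exact (hu s t hs0.le hst v hv).2
  rw [inner_neg_left, ← inner_neg_right, neg_sub, real_inner_comm]
  linarith

theorem isGradientFlow [CompleteSpace H] {u : ℝ → H} (hu : IsEVISolution W u)
    (hne : (effDomain W).Nonempty) (h0 : ContinuousWithinAt u (Ici 0) 0)
    (hlip : ∀ a, 0 < a → ∃ C : ℝ≥0, LipschitzOnWith C u (Ici a)) :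
    IsGradientFlow W (u 0) fun t => u t := by
  have hlipIcc : ∀ a b, 0 < a → ∃ C : ℝ≥0, LipschitzOnWith C u (Icc a b) := fun a b ha =>
    (hlip a ha).imp fun C hC => hC.mono Icc_subset_Ici_self
  have hcont : ContinuousOn u (Ici 0) := by
    intro t (ht : 0 ≤ t)
    rcases ht.eq_or_lt with rfl | ht
    · exact h0
    · obtain ⟨C, hC⟩ := hlip (t / 2) (half_pos ht)
      exact (hC.continuousOn.continuousAt (Ici_mem_nhds (half_lt_self ht))).continuousWithinAt
  have hdiff : ∀ᵐ t, ∀ a b : ℚ, 0 < (a : ℝ) → t ∈ Ioo (a : ℝ) b → DifferentiableAt ℝ u t := by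
    simp only [ae_all_iff]
    intro a b ha
    obtain ⟨C, hC⟩ := hlipIcc a b ha
    exact ae_differentiableAt_of_lipschitzOnWith hC
  refine ⟨hcont.comp_continuous NNReal.continuous_coe fun t => t.2, congrArg u NNReal.coe_zero,
    deriv u, fun a b ha _ => ?_, fun a b ha hab => ?_, ?_⟩
  · obtain ⟨C, hC⟩ := hlip (a / 2) (half_pos ha)
    refine MemLp.of_bound (stronglyMeasurable_deriv u).aestronglyMeasurable C ?_
    filter_upwards [ae_restrict_mem measurableSet_Icc] with t ht
    exact norm_deriv_le_of_lipschitzOn (Ici_mem_nhds ((half_lt_self ha).trans_le ht.1)) hC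
  · obtain ⟨C, hC⟩ := hlipIcc a b ha
    exact (integral_deriv_of_lipschitzOnWith (NNReal.coe_le_coe.2 hab.le) hC).symm
  · rw [ae_restrict_iff' measurableSet_Ioi]
    filter_upwards [hdiff] with t ht (ht0 : 0 < t)
    obtain ⟨a, ha0, hat⟩ := exists_rat_btwn ht0
    obtain ⟨b, htb, -⟩ := exists_rat_btwn (lt_add_one t)
    rw [Real.coe_toNNReal t ht0.le]
    exact hu.neg_deriv_mem_subgradient hne ht0 (ht a b ha0 ⟨hat, htb⟩)

end IsEVISolution

theorem ConvexEnergy.exists_isGradientFlow [CompleteSpace H] (hc : ConvexEnergy W)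
    (hW : LowerSemicontinuous W) {x : H} (hx : x ∈ closure (effDomain W)) :
    ∃ u, IsGradientFlow W x u := by
  have hne : (effDomain W).Nonempty := closure_nonempty_iff.1 ⟨x, hx⟩
  obtain ⟨v, hv⟩ := id hne
  obtain ⟨J, hJ⟩ := hc.exists_isResolventFamily hW hne
  have hzero : eulerLimit J 0 x = x := by
    simp only [eulerLimit, euler, zero_div, Nat.floor_zero, Function.iterate_zero, id_eq]
    exact tendsto_const_nhds.limUnder_eq
  have hflow := (hJ.isEVISolution_eulerLimit hW hx).isGradientFlow hne
    (by rw [ContinuousWithinAt, hzero]; exact hJ.tendsto_eulerLimit_zero hx) fun a ha =>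
      ⟨_, mul_div_cancel₀ a (four_ne_zero (α := ℝ)) ▸
        hJ.lipschitzOnWith_eulerLimit hx hv (div_pos ha four_pos)⟩
  rw [hzero] at hflow
  exact ⟨_, hflow⟩

end Existence

/-! ### Comparison of gradient flows -/

theorem absolutelyContinuousOnInterval_of_dist_le {X Y : Type*} [PseudoMetricSpace X]
    [PseudoMetricSpace Y] {f : ℝ → X} {F : ℝ → Y} {a b : ℝ}
    (hF : AbsolutelyContinuousOnInterval F a b)
    (h : ∀ s ∈ uIcc a b, ∀ t ∈ uIcc a b, dist (f s) (f t) ≤ dist (F s) (F t)) :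
    AbsolutelyContinuousOnInterval f a b := by
  rw [absolutelyContinuousOnInterval_iff] at hF ⊢
  intro ε hε
  obtain ⟨δ, hδ, hFδ⟩ := hF ε hε
  refine ⟨δ, hδ, fun E hE hlen => (Finset.sum_le_sum fun i hi => ?_).trans_lt (hFδ E hE hlen)⟩
  have hEi := hE.1 i hi
  exact h _ hEi.1 _ hEi.2

theorem le_of_absolutelyContinuousOnInterval_of_deriv_nonpos {φ : ℝ → ℝ} {a b : ℝ} (hab : a ≤ b)
    (hφ : AbsolutelyContinuousOnInterval φ a b)
    (hle : ∀ᵐ t ∂volume.restrict (Ioo a b), deriv φ t ≤ 0) : φ b ≤ φ a := by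
  have hint : ∫ t in a..b, deriv φ t ≤ 0 := by
    rw [intervalIntegral.integral_of_le hab, integral_Ioc_eq_integral_Ioo]
    exact integral_nonpos_of_ae hle
  linarith [hφ.integral_deriv_eq_sub]

theorem deriv_eq_of_le_of_eq {φ f : ℝ → ℝ} {f' t : ℝ} (hf : HasDerivAt f f' t)
    (hφ : DifferentiableAt ℝ φ t) (hle : ∀ s, φ s ≤ f s) (heq : φ t = f t) : deriv φ t = f' := by
  have hmin : IsLocalMin (fun s => f s - φ s) t :=
    Eventually.of_forall fun s => by simpa only [heq, sub_self] using sub_nonneg.2 (hle s)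
  linarith [hmin.hasDerivAt_eq_zero (hf.sub hφ.hasDerivAt)]

section Lyapunov

variable {H : Type*} [NormedAddCommGroup H] [InnerProductSpace ℝ H]

theorem absolutelyContinuousOnInterval_of_primitive {z g : ℝ → H} {a b : ℝ} (hab : a ≤ b)
    (hg : IntegrableOn g (Ioc a b)) (hz : ∀ t ∈ Icc a b, z t - z a = ∫ s in a..t, g s) :
    AbsolutelyContinuousOnInterval z a b := by
  have hgi : IntervalIntegrable g volume a b :=
    (intervalIntegrable_iff_integrableOn_Ioc_of_le hab).2 hg
  refine absolutelyContinuousOnInterval_of_dist_le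
    (hgi.norm.absolutelyContinuousOnInterval_intervalIntegral left_mem_uIcc) fun s hs t ht => ?_
  have hgs : IntervalIntegrable g volume a s :=
    hgi.mono_set (uIcc_subset_uIcc_left hs)
  have hgt : IntervalIntegrable g volume a t :=
    hgi.mono_set (uIcc_subset_uIcc_left ht)
  rw [uIcc_of_le hab] at hs ht
  rw [dist_eq_norm, Real.dist_eq, ← sub_sub_sub_cancel_right (z s) (z t) (z a), hz s hs, hz t ht,
    intervalIntegral.integral_interval_sub_left hgs hgt,
    intervalIntegral.integral_interval_sub_left hgs.norm hgt.norm]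
  exact intervalIntegral.norm_integral_le_abs_integral_norm

/-- The quadratic bound says that `2 G` is the gradient of `‖G‖²`, so that `‖G(z)‖²` decreases
along `z`. -/
theorem norm_sq_le_of_inner_nonpos [CompleteSpace H] {z g : ℝ → H} {G : H → H} {a b : ℝ}
    (hab : a ≤ b) (hg : IntegrableOn g (Ioc a b))
    (hz : ∀ t ∈ Icc a b, z t - z a = ∫ s in a..t, g s) (hG : LipschitzWith 1 G)
    (hquad : ∀ x y, ‖G y‖ ^ 2 ≤ ‖G x‖ ^ 2 + 2 * inner ℝ (G x) (y - x) + ‖y - x‖ ^ 2)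
    (hle : ∀ᵐ t ∂volume.restrict (Ioc a b), inner ℝ (G (z t)) (g t) ≤ 0) :
    ‖G (z b)‖ ^ 2 ≤ ‖G (z a)‖ ^ 2 := by
  have hGz : AbsolutelyContinuousOnInterval (fun t => ‖G (z t)‖) a b := by
    refine absolutelyContinuousOnInterval_of_dist_le
      (absolutelyContinuousOnInterval_of_primitive hab hg hz) fun s _ t _ => ?_
    exact (dist_norm_norm_le _ _).trans ((dist_eq_norm _ _).symm.trans_le
      (by simpa using hG.dist_le_mul (z s) (z t)))
  have hac : AbsolutelyContinuousOnInterval (fun t => ‖G (z t)‖ ^ 2) a b := by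
    simpa only [sq] using! hGz.mul hGz
  refine le_of_absolutelyContinuousOnInterval_of_deriv_nonpos
    (φ := fun t => ‖G (z t)‖ ^ 2) hab hac ?_
  rw [← Measure.restrict_congr_set Ioo_ae_eq_Ioc] at hle
  filter_upwards [hle, ae_restrict_of_ae hac.ae_differentiableAt,
    ae_restrict_of_ae (ae_hasDerivAt_of_primitive hg hz), ae_restrict_mem measurableSet_Ioo]
    with t hinner hdiff hderiv htmem
  have hzt := (hderiv htmem).sub_const (z t)
  have hbound : HasDerivAt
      (fun s => ‖G (z t)‖ ^ 2 + 2 * inner ℝ (G (z t)) (z s - z t) + ‖z s - z t‖ ^ 2)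
      (2 * inner ℝ (G (z t)) (g t)) t := by
    simpa using! ((((hasDerivAt_const t (G (z t))).inner ℝ hzt).const_mul 2).const_add
      (‖G (z t)‖ ^ 2)).add hzt.norm_sq
  rw [deriv_eq_of_le_of_eq hbound (hdiff (Ioo_subset_Icc_self.trans Icc_subset_uIcc htmem))
    (fun s => hquad (z t) (z s)) (by simp)]
  linarith

end Lyapunov

theorem inner_sub_nonneg_of_subgradient {H : Type*} [NormedAddCommGroup H]
    [InnerProductSpace ℝ H] {W₁ W₂ : H → ℝ≥0∞} {u v f g w : H}
    (hf : f ∈ subgradient W₁ u) (hg : g ∈ subgradient W₂ v)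
    (h : W₁ (u - w) + W₂ (v + w) ≤ W₁ u + W₂ v) : 0 ≤ inner ℝ w (f - g) := by
  rw [mem_subgradient_iff] at hf hg
  have hfin : W₁ u + W₂ v < ∞ := ENNReal.add_lt_top.2 ⟨hf.1, hg.1⟩
  obtain ⟨hfinu, hfinv⟩ := ENNReal.add_lt_top.1 (h.trans_lt hfin)
  have hreal := ENNReal.toReal_mono hfin.ne h
  rw [ENNReal.toReal_add hfinu.ne hfinv.ne, ENNReal.toReal_add hf.1.ne hg.1.ne] at hreal
  have hsubu := hf.2 _ hfinu
  have hsubv := hg.2 _ hfinv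
  rw [sub_sub_cancel_left, inner_neg_right] at hsubu
  rw [add_sub_cancel_left] at hsubv
  rw [real_inner_comm, inner_sub_left]
  linarith

theorem IsGradientFlow.exists_primitive {H : Type*} [NormedAddCommGroup H]
    [InnerProductSpace ℝ H] {W : H → ℝ≥0∞} {u₀ : H} {u : ℝ≥0 → H} (hu : IsGradientFlow W u₀ u) :
    ∃ g : ℝ → H, ∀ a b : ℝ, 0 < a → a ≤ b → IntegrableOn g (Ioc a b) ∧
      u b.toNNReal - u a.toNNReal = ∫ t in a..b, g t ∧
      ∀ᵐ t ∂volume.restrict (Ioc a b), -g t ∈ subgradient W (u t.toNNReal) := by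
  obtain ⟨-, -, g, hgmem, hgint, hgsub⟩ := hu
  refine ⟨g, fun a b ha hab => ⟨?_, ?_, ?_⟩⟩
  · have hg := (hgmem a (b + 1) ha (by linarith)).integrable one_le_two
    exact IntegrableOn.mono_set hg fun t ht => ⟨ht.1.le, by linarith [ht.2]⟩
  · rcases hab.eq_or_lt with rfl | hlt
    · simp
    · have hprim := hgint a.toNNReal b.toNNReal (Real.toNNReal_pos.2 ha)
        ((Real.toNNReal_lt_toNNReal_iff (ha.trans hlt)).2 hlt)
      rwa [Real.coe_toNNReal a ha.le, Real.coe_toNNReal b (ha.trans hlt).le] at hprim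
  · exact ae_restrict_of_ae_restrict_of_subset (fun t ht => ha.trans ht.1) hgsub

section Comparison

variable {X : Type*} [MeasurableSpace X] {μ : Measure X}

theorem norm_posPart_sub_sq_le (k x y : Lp ℝ 2 μ) :
    ‖(y - k)⁺‖ ^ 2 ≤ ‖(x - k)⁺‖ ^ 2 + 2 * inner ℝ (x - k)⁺ (y - x) + ‖y - x‖ ^ 2 := by
  rw [← norm_add_sq_real]
  gcongr
  apply norm_le_norm_of_abs_le_abs
  rw [abs_of_nonneg (posPart_nonneg _)]
  refine sup_le ?_ (abs_nonneg _)
  calc y - k = (x - k) + (y - x) := by abel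
    _ ≤ (x - k)⁺ + (y - x) := by gcongr; exact le_posPart _
    _ ≤ |(x - k)⁺ + (y - x)| := le_abs_self _

theorem lipschitzWith_posPart_sub (k : Lp ℝ 2 μ) : LipschitzWith 1 fun x => (x - k)⁺ := by
  simpa using! lipschitzWith_posPart.comp (LipschitzWith.id.sub (LipschitzWith.const k))

variable {W₁ W₂ : Lp ℝ 2 μ → ℝ≥0∞} {u₀ v₀ k : Lp ℝ 2 μ} {u v : ℝ≥0 → Lp ℝ 2 μ}

theorem IsGradientFlow.norm_posPart_sub_sq_antitone (hu : IsGradientFlow W₁ u₀ u)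
    (hv : IsGradientFlow W₂ v₀ v)
    (h : ∀ t, W₁ (u t - (u t - v t - k)⁺) + W₂ (v t + (u t - v t - k)⁺) ≤ W₁ (u t) + W₂ (v t))
    {a b : ℝ≥0} (ha : 0 < a) (hab : a ≤ b) :
    ‖(u b - v b - k)⁺‖ ^ 2 ≤ ‖(u a - v a - k)⁺‖ ^ 2 := by
  obtain ⟨f, hf⟩ := hu.exists_primitive
  obtain ⟨g, hg⟩ := hv.exists_primitive
  have ha' : 0 < (a : ℝ) := ha
  have hab' : (a : ℝ) ≤ b := hab
  obtain ⟨hfint, -, hfsub⟩ := hf a b ha' hab'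
  obtain ⟨hgint, -, hgsub⟩ := hg a b ha' hab'
  have hprim : ∀ t ∈ Icc (a : ℝ) b, u t.toNNReal - v t.toNNReal
      - (u (a : ℝ).toNNReal - v (a : ℝ).toNNReal) = ∫ s in (a : ℝ)..t, (f s - g s) := by
    intro t ht
    obtain ⟨hfi, hft, -⟩ := hf a t ha' ht.1
    obtain ⟨hgi, hgt, -⟩ := hg a t ha' ht.1
    rw [intervalIntegral.integral_sub ((intervalIntegrable_iff_integrableOn_Ioc_of_le ht.1).2 hfi)
      ((intervalIntegrable_iff_integrableOn_Ioc_of_le ht.1).2 hgi), ← hft, ← hgt]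
    abel
  have hmono := norm_sq_le_of_inner_nonpos (z := fun t => u t.toNNReal - v t.toNNReal)
    (g := fun t => f t - g t) hab' (hfint.sub hgint) hprim (lipschitzWith_posPart_sub k)
    (norm_posPart_sub_sq_le k) ?_
  · simpa only [Real.toNNReal_coe] using hmono
  · filter_upwards [hfsub, hgsub] with t hft hgt
    have hinner := inner_sub_nonneg_of_subgradient hft hgt (h t.toNNReal)
    rw [← neg_sub', inner_neg_right] at hinner
    exact nonpos_of_neg_nonneg hinner

theorem IsGradientFlow.sub_le_of_posPart (hu : IsGradientFlow W₁ u₀ u)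
    (hv : IsGradientFlow W₂ v₀ v)
    (h : ∀ t, W₁ (u t - (u t - v t - k)⁺) + W₂ (v t + (u t - v t - k)⁺) ≤ W₁ (u t) + W₂ (v t))
    (h₀ : u₀ - v₀ ≤ k) (t : ℝ≥0) : u t - v t ≤ k := by
  have huc : Continuous u := hu.1
  have hvc : Continuous v := hv.1
  have hcont : Continuous fun s => ‖(u s - v s - k)⁺‖ ^ 2 :=
    (((lipschitzWith_posPart_sub k).continuous.comp (huc.sub hvc)).norm).pow 2
  have hzero : ‖(u 0 - v 0 - k)⁺‖ ^ 2 = 0 := by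
    rw [hu.2.1, hv.2.1, posPart_eq_zero.2 (sub_nonpos.2 h₀), norm_zero, zero_pow two_ne_zero]
  have hle : ‖(u t - v t - k)⁺‖ ^ 2 ≤ 0 := by
    rcases eq_zero_or_pos t with rfl | ht
    · exact hzero.le
    · have hlim : Tendsto (fun s => ‖(u s - v s - k)⁺‖ ^ 2) (𝓝[>] 0) (𝓝 0) :=
        (hcont.tendsto' 0 0 hzero).mono_left nhdsWithin_le_nhds
      refine ge_of_tendsto hlim ?_
      filter_upwards [Ioc_mem_nhdsGT ht] with s hs
      exact hu.norm_posPart_sub_sq_antitone hv h hs.1 hs.2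
  have hpos : (u t - v t - k)⁺ = 0 :=
    norm_eq_zero.1 (pow_eq_zero_iff two_ne_zero |>.1 (hle.antisymm (sq_nonneg _)))
  exact sub_nonpos.1 (posPart_eq_zero.1 hpos)

end Comparison

namespace Gasket

/-! ### Barycentric coordinates and cells of the gasket -/

/-- `p` consists of the vertices of a regular simplex with edges of length one. -/
def IsUnitSimplex {N : ℕ} (p : Fin N → Space N) : Prop :=
  ∀ i j, i ≠ j → dist (p i) (p j) = 1

section Geometry

variable {N : ℕ} {p : Fin N → Space N}

/-- The barycentric coordinates with respect to a regular simplex with edges of length one,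
expressed by squared distances to the vertices; the quadratic terms cancel. -/
def bary (p : Fin N → Space N) (i : Fin N) (x : Space N) : ℝ :=
  1 / N + 1 / N * ∑ k, ‖x - p k‖ ^ 2 - ‖x - p i‖ ^ 2

theorem natCast_ne_zero (i : Fin N) : (N : ℝ) ≠ 0 :=
  Nat.cast_ne_zero.2 i.pos.ne'

theorem continuous_bary (i : Fin N) : Continuous (bary p i) := by
  unfold bary
  fun_prop

theorem bary_simMap (i j : Fin N) (x : Space N) :
    bary p j (simMap p i x) = 1 / 2 * bary p j x + 1 / 2 * bary p j (p i) := by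
  have hN := natCast_ne_zero i
  unfold bary simMap
  simp only [norm_midpoint_sub_sq, Finset.sum_sub_distrib, Finset.sum_add_distrib,
    ← Finset.mul_sum, Finset.sum_const, Finset.card_univ, Fintype.card_fin, nsmul_eq_mul]
  field_simp
  ring

theorem IsUnitSimplex.norm_sub_sq (hp : IsUnitSimplex p) (i j : Fin N) :
    ‖p i - p j‖ ^ 2 = 1 - if i = j then 1 else 0 := by
  split_ifs with h
  · simp [h]
  · rw [← dist_eq_norm, hp i j h]
    norm_num

theorem IsUnitSimplex.bary_vertex (hp : IsUnitSimplex p) (i j : Fin N) :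
    bary p i (p j) = if i = j then 1 else 0 := by
  have hN := natCast_ne_zero i
  simp only [bary, hp.norm_sub_sq, Finset.sum_sub_distrib, Finset.sum_ite_eq, Finset.mem_univ,
    if_true, Finset.sum_const, Finset.card_univ, Fintype.card_fin, nsmul_eq_mul, mul_one]
  simp only [eq_comm (a := j)]
  field_simp
  ring

theorem sum_bary (hN : N ≠ 0) (x : Space N) : ∑ i, bary p i x = 1 := by
  have hN' : (N : ℝ) ≠ 0 := Nat.cast_ne_zero.2 hN
  simp only [bary, Finset.sum_sub_distrib, Finset.sum_const, Finset.card_univ, Fintype.card_fin,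
    nsmul_eq_mul]
  field_simp
  ring

theorem gasket_subset {K : Set (Space N)} (hK : IsClosed K) (hvertex : ∀ i, p i ∈ K)
    (hsim : ∀ i, MapsTo (simMap p i) K K) : gasket p ⊆ K := by
  refine closure_minimal (iUnion_subset fun m => ?_) hK
  induction m with
  | zero => exact range_subset_iff.2 hvertex
  | succ m ih => exact iUnion_subset fun i => ((hsim i).mono_left ih).image_subset

theorem IsUnitSimplex.bary_nonneg (hp : IsUnitSimplex p) {x : Space N} (hx : x ∈ gasket p)
    (i : Fin N) : 0 ≤ bary p i x := by
  have hvertex : ∀ j, 0 ≤ bary p i (p j) := fun j => by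
    rw [hp.bary_vertex]
    split_ifs <;> norm_num
  refine gasket_subset (K := {x | 0 ≤ bary p i x})
    (isClosed_le continuous_const (continuous_bary i)) hvertex (fun j y hy => ?_) hx
  rw [mem_ofPred_eq] at hy ⊢
  have := hvertex j
  rw [bary_simMap]
  positivity

theorem IsUnitSimplex.eq_sum_bary (hp : IsUnitSimplex p) {x : Space N} (hx : x ∈ gasket p) :
    x = ∑ i, bary p i x • p i := by
  have hvertex : ∀ j, p j = ∑ i, bary p i (p j) • p i := fun j => by
    simp [hp.bary_vertex]
  refine gasket_subset (K := {x | x = ∑ i, bary p i x • p i})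
    (isClosed_eq continuous_id (continuous_finsetSum _ fun i _ =>
      (continuous_bary i).smul continuous_const)) hvertex (fun j y hy => ?_) hx
  have hy' : y = ∑ i, bary p i y • p i := hy
  simp only [mem_ofPred_eq, bary_simMap, add_smul, Finset.sum_add_distrib, mul_smul,
    ← Finset.smul_sum]
  rw [← hy', ← hvertex j, simMap]

theorem IsUnitSimplex.eq_vertex_of_bary_eq_one (hp : IsUnitSimplex p) {x : Space N}
    (hx : x ∈ gasket p) {j : Fin N} (h : bary p j x = 1) : x = p j := by
  have hsum := sum_bary (p := p) j.pos.ne' x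
  rw [← Finset.add_sum_erase _ _ (Finset.mem_univ j), h, add_eq_left,
    Finset.sum_eq_zero_iff_of_nonneg fun k _ => hp.bary_nonneg hx k] at hsum
  rw [hp.eq_sum_bary hx, ← Finset.add_sum_erase _ _ (Finset.mem_univ j),
    Finset.sum_eq_zero fun k hk => by rw [hsum k hk, zero_smul], add_zero, h, one_smul]

theorem IsUnitSimplex.bary_le_one (hp : IsUnitSimplex p) {x : Space N} (hx : x ∈ gasket p)
    (i : Fin N) : bary p i x ≤ 1 := by
  rw [← sum_bary (p := p) i.pos.ne' x]
  exact Finset.single_le_sum (fun j _ => hp.bary_nonneg hx j) (Finset.mem_univ i)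

theorem IsUnitSimplex.isCompact_gasket (hp : IsUnitSimplex p) : IsCompact (gasket p) := by
  refine Metric.isCompact_of_isClosed_isBounded isClosed_closure ?_
  refine isBounded_iff_forall_norm_le.2 ⟨∑ i, ‖p i‖, fun x hx => ?_⟩
  rw [hp.eq_sum_bary hx]
  refine norm_sum_le_of_le _ fun i _ => ?_
  rw [norm_smul, Real.norm_of_nonneg (hp.bary_nonneg hx i)]
  exact mul_le_of_le_one_left (norm_nonneg _) (hp.bary_le_one hx i)

theorem IsUnitSimplex.compactSpace_gasket (hp : IsUnitSimplex p) : CompactSpace (gasket p) :=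
  isCompact_iff_compactSpace.1 hp.isCompact_gasket

theorem continuous_simMap (i : Fin N) : Continuous (simMap p i) := by
  unfold simMap
  fun_prop

theorem simMap_injective (i : Fin N) : Function.Injective (simMap p i) := fun _ _ h =>
  smul_right_injective _ (by norm_num : (1 / 2 : ℝ) ≠ 0) (add_right_cancel h)

theorem simMap_vertex_self (i : Fin N) : simMap p i (p i) = p i := by
  unfold simMap
  module

theorem simMap_vertex_comm (i j : Fin N) : simMap p i (p j) = simMap p j (p i) :=
  add_comm _ _

theorem dist_simMap (i : Fin N) (x y : Space N) :
    dist (simMap p i x) (simMap p i y) = 1 / 2 * dist x y := by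
  rw [simMap, simMap, dist_add_right, dist_smul₀, Real.norm_of_nonneg (by norm_num)]

theorem mapsTo_simMap_gasket (i : Fin N) : MapsTo (simMap p i) (gasket p) (gasket p) := by
  refine MapsTo.closure (fun y hy => ?_) (continuous_simMap i)
  obtain ⟨m, hm⟩ := mem_iUnion.1 hy
  exact mem_iUnion.2 ⟨m + 1, mem_iUnion.2 ⟨i, y, hm, rfl⟩⟩

theorem mapsTo_wordMap_gasket (w : List (Fin N)) :
    MapsTo (wordMap p w) (gasket p) (gasket p) := by
  induction w with
  | nil => exact mapsTo_id _
  | cons i w ih => exact (mapsTo_simMap_gasket i).comp ih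

theorem IsUnitSimplex.gasket_subset_iUnion_simMap (hp : IsUnitSimplex p) :
    gasket p ⊆ ⋃ i, simMap p i '' gasket p := by
  refine gasket_subset (isClosed_iUnion_of_finite fun i =>
    (hp.isCompact_gasket.image (continuous_simMap i)).isClosed)
    (fun i => mem_iUnion.2 ⟨i, p i, (bdry p i).2, simMap_vertex_self i⟩) fun i x hx => ?_
  obtain ⟨j, y, hy, rfl⟩ := mem_iUnion.1 hx
  exact mem_iUnion.2 ⟨i, _, mapsTo_simMap_gasket j hy, rfl⟩

theorem IsUnitSimplex.eq_vertex_of_simMap_eq (hp : IsUnitSimplex p) {x y : Space N}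
    (hx : x ∈ gasket p) (hy : y ∈ gasket p) {i j : Fin N} (hij : i ≠ j)
    (h : simMap p i x = simMap p j y) : x = p j := by
  refine hp.eq_vertex_of_bary_eq_one hx (le_antisymm (hp.bary_le_one hx j) ?_)
  have hbary := congrArg (bary p j) h
  rw [bary_simMap, bary_simMap, hp.bary_vertex, hp.bary_vertex, if_neg hij.symm,
    if_pos rfl] at hbary
  linarith [hp.bary_nonneg hy j]

theorem vertex_mem_vertexSet (i : Fin N) (m : ℕ) : p i ∈ vertexSet p m := by
  induction m with
  | zero => exact mem_range_self i
  | succ m ih => exact mem_iUnion.2 ⟨i, p i, ih, simMap_vertex_self i⟩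

theorem IsUnitSimplex.mem_vertexSet_of_simMap_mem (hp : IsUnitSimplex p) {x : Space N}
    (hx : x ∈ gasket p) {i : Fin N} {m : ℕ} (h : simMap p i x ∈ vertexSet p (m + 1)) :
    x ∈ vertexSet p m := by
  obtain ⟨j, y, hy, hyx⟩ := mem_iUnion.1 h
  rcases eq_or_ne i j with rfl | hij
  · rwa [← simMap_injective i hyx]
  · rw [hp.eq_vertex_of_simMap_eq hx (vertexSet_subset_gasket p m hy) hij hyx.symm]
    exact vertex_mem_vertexSet j m

/-- The similarity `F_i`, as a map of the gasket onto one of its cells of level one. -/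
def cellMap (p : Fin N → Space N) (i : Fin N) (x : gasket p) : gasket p :=
  ⟨simMap p i x, mapsTo_simMap_gasket i x.2⟩

theorem continuous_cellMap (i : Fin N) : Continuous (cellMap p i) :=
  ((continuous_simMap i).comp continuous_subtype_val).subtype_mk _

theorem cellMap_injective (i : Fin N) : Function.Injective (cellMap p i) := fun _ _ h =>
  Subtype.ext (simMap_injective i (congrArg Subtype.val h))

theorem dist_cellMap (i : Fin N) (x y : gasket p) :
    dist (cellMap p i x) (cellMap p i y) = 1 / 2 * dist x y :=
  dist_simMap i x y

theorem cellMap_bdry_self (i : Fin N) : cellMap p i (bdry p i) = bdry p i :=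
  Subtype.ext (simMap_vertex_self i)

theorem cellMap_bdry_comm (i j : Fin N) : cellMap p i (bdry p j) = cellMap p j (bdry p i) :=
  Subtype.ext (simMap_vertex_comm i j)

theorem IsUnitSimplex.bdry_injective (hp : IsUnitSimplex p) : Function.Injective (bdry p) := by
  intro i j h
  by_contra hij
  have hdist := hp i j hij
  rw [show p i = p j from congrArg Subtype.val h, dist_self] at hdist
  exact zero_ne_one hdist

theorem IsUnitSimplex.eq_bdry_of_cellMap_eq (hp : IsUnitSimplex p) {x y : gasket p}
    {i j : Fin N} (hij : i ≠ j) (h : cellMap p i x = cellMap p j y) : x = bdry p j :=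
  Subtype.ext (hp.eq_vertex_of_simMap_eq x.2 y.2 hij (congrArg Subtype.val h))

theorem IsUnitSimplex.exists_cellMap_eq (hp : IsUnitSimplex p) (x : gasket p) :
    ∃ i y, cellMap p i y = x := by
  obtain ⟨i, y, hy, hyx⟩ := mem_iUnion.1 (hp.gasket_subset_iUnion_simMap x.2)
  exact ⟨i, ⟨y, hy⟩, Subtype.ext hyx⟩

theorem IsUnitSimplex.cellMap_mem_vertices (hp : IsUnitSimplex p) {m : ℕ} {i : Fin N}
    {x : gasket p} : cellMap p i x ∈ vertices p (m + 1) ↔ x ∈ vertices p m := by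
  rw [mem_vertices, mem_vertices]
  exact ⟨fun h => hp.mem_vertexSet_of_simMap_mem x.2 h, fun h => mem_iUnion.2 ⟨i, x, h, rfl⟩⟩

theorem vertices_zero [DecidableEq (gasket p)] : vertices p 0 = Finset.univ.image (bdry p) := by
  ext x
  simp only [mem_vertices, vertexSet, mem_range, Finset.mem_image, Finset.mem_univ, true_and,
    Subtype.ext_iff, bdry]

theorem sameCell_zero (x y : gasket p) : SameCell p 0 x y :=
  ⟨[], rfl, ⟨x, x.2, rfl⟩, ⟨y, y.2, rfl⟩⟩

theorem sameCell_succ_iff {m : ℕ} {x y : gasket p} :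
    SameCell p (m + 1) x y ↔
      ∃ i x' y', SameCell p m x' y' ∧ cellMap p i x' = x ∧ cellMap p i y' = y := by
  constructor
  · rintro ⟨w, hw, ⟨a, ha, hax⟩, ⟨b, hb, hby⟩⟩
    obtain ⟨i, w, rfl⟩ := List.exists_cons_of_length_eq_add_one hw
    exact ⟨i, ⟨_, mapsTo_wordMap_gasket w ha⟩, ⟨_, mapsTo_wordMap_gasket w hb⟩,
      ⟨w, by simpa using hw, ⟨a, ha, rfl⟩, ⟨b, hb, rfl⟩⟩, Subtype.ext hax, Subtype.ext hby⟩
  · rintro ⟨i, x', y', ⟨w, hw, ⟨a, ha, hax⟩, ⟨b, hb, hby⟩⟩, rfl, rfl⟩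
    exact ⟨i :: w, by simp [hw], ⟨a, ha, congrArg (simMap p i) hax⟩,
      ⟨b, hb, congrArg (simMap p i) hby⟩⟩

end Geometry

end Gasket

/-! ### Harmonic extension from a simplex to its midpoints -/

section Simplex

variable {N : ℕ}

theorem sum_sum_sub_mul_sub (a b : Fin N → ℝ) :
    ∑ j, ∑ k, (a j - a k) * (b j - b k) =
      2 * (N * ∑ j, a j * b j - (∑ j, a j) * ∑ j, b j) := by
  have hexpand : ∀ j k,
      (a j - a k) * (b j - b k) = a j * b j + a k * b k - a j * b k - a k * b j :=
    fun j k => by ring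
  simp only [hexpand, Finset.sum_sub_distrib, Finset.sum_add_distrib, Finset.sum_const,
    Finset.card_univ, Fintype.card_fin, nsmul_eq_mul, ← Finset.mul_sum, ← Finset.sum_mul]
  ring

theorem sum_sum_sub_sq (c : Fin N → ℝ) :
    ∑ i, ∑ j, (c i - c j) ^ 2 = 2 * ∑ i, (N * c i - ∑ k, c k) * c i := by
  simp only [sq]
  rw [sum_sum_sub_mul_sub]
  simp only [sub_mul, Finset.sum_sub_distrib, mul_assoc, ← Finset.mul_sum]

theorem sum_sum_sub_mul_eq_zero (c : Fin N → ℝ) {x : Fin N → Fin N → ℝ}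
    (hx : ∀ i j, x i j = x j i) : ∑ i, ∑ j, (c j - c i) * x i j = 0 := by
  simp only [sub_mul, Finset.sum_sub_distrib, sub_eq_zero]
  rw [Finset.sum_comm]
  simp only [hx]

/-- The harmonic extension of the values `c` at the vertices of a simplex to the midpoints of its
edges: the value at the midpoint of `p_i` and `p_j`, or at `p_i` if `i = j`. -/
def harmonicExt (c : Fin N → ℝ) (i j : Fin N) : ℝ :=
  (c i + c j + ∑ k, c k + if i = j then N * c i - ∑ k, c k else 0) / (N + 2)

theorem harmonicExt_comm (c : Fin N → ℝ) (i j : Fin N) :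
    harmonicExt c i j = harmonicExt c j i := by
  rcases eq_or_ne i j with rfl | h
  · rfl
  · simp only [harmonicExt, if_neg h, if_neg h.symm, add_comm (c i)]

theorem harmonicExt_self (c : Fin N → ℝ) (i : Fin N) : harmonicExt c i i = c i := by
  simp only [harmonicExt, if_true]
  field_simp
  ring

theorem sum_harmonicExt (c : Fin N → ℝ) (i : Fin N) :
    ∑ j, harmonicExt c i j = N * (2 * c i + ∑ k, c k) / (N + 2) := by
  simp only [harmonicExt, ← Finset.sum_div, Finset.sum_add_distrib, Finset.sum_ite_eq,
    Finset.mem_univ, if_true, Finset.sum_const, Finset.card_univ, Fintype.card_fin, nsmul_eq_mul]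
  ring

theorem sum_sum_harmonicExt_sub_mul_sub (c a : Fin N → ℝ) (i : Fin N) :
    ∑ j, ∑ k, (harmonicExt c i j - harmonicExt c i k) * (a j - a k) =
      2 * (N / (N + 2)) * (∑ j, (c j - c i) * a j + (N * c i - ∑ k, c k) * a i) := by
  have hdiag : (N * c i - ∑ k, c k) * a i =
      ∑ j, (if i = j then N * c i - ∑ k, c k else 0) * a j := by
    simp only [ite_mul, zero_mul, Finset.sum_ite_eq, Finset.mem_univ, if_true]
  rw [sum_sum_sub_mul_sub, sum_harmonicExt, hdiag, ← Finset.sum_add_distrib, Finset.mul_sum,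
    Finset.mul_sum, ← Finset.sum_sub_distrib, Finset.mul_sum, Finset.mul_sum]
  refine Finset.sum_congr rfl fun j _ => ?_
  simp only [harmonicExt]
  field_simp
  ring

-- The right-hand side depends on `x` through its diagonal only: `harmonicExt c` is harmonic.
theorem sum_harmonicExt_mul {c : Fin N → ℝ} {x : Fin N → Fin N → ℝ}
    (hx : ∀ i j, x i j = x j i) (hdiag : ∀ i, x i i = c i) :
    ∑ i, ∑ j, ∑ k, (harmonicExt c i j - harmonicExt c i k) * (x i j - x i k) =
      N / (N + 2) * ∑ i, ∑ j, (c i - c j) ^ 2 := by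
  simp only [sum_sum_harmonicExt_sub_mul_sub, hdiag]
  rw [← Finset.mul_sum, Finset.sum_add_distrib, sum_sum_sub_mul_eq_zero c hx, sum_sum_sub_sq]
  ring

theorem sum_harmonicExt_sq (c : Fin N → ℝ) :
    ∑ i, ∑ j, ∑ k, (harmonicExt c i j - harmonicExt c i k) ^ 2 =
      N / (N + 2) * ∑ i, ∑ j, (c i - c j) ^ 2 := by
  simp only [sq (harmonicExt c _ _ - harmonicExt c _ _)]
  exact sum_harmonicExt_mul (harmonicExt_comm c) (harmonicExt_self c)

theorem sum_harmonicExt_sq_le {x : Fin N → Fin N → ℝ} (hx : ∀ i j, x i j = x j i) :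
    ∑ i, ∑ j, ∑ k, (harmonicExt (fun l => x l l) i j - harmonicExt (fun l => x l l) i k) ^ 2 ≤
      ∑ i, ∑ j, ∑ k, (x i j - x i k) ^ 2 := by
  set h := harmonicExt fun l => x l l with hh
  have hnonneg : 0 ≤ ∑ i, ∑ j, ∑ k, ((x i j - h i j) - (x i k - h i k)) ^ 2 := by positivity
  have hexpand : ∀ i j k, ((x i j - h i j) - (x i k - h i k)) ^ 2 = (x i j - x i k) ^ 2
      - 2 * ((h i j - h i k) * (x i j - x i k)) + (h i j - h i k) ^ 2 := fun i j k => by ring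
  have horth : ∑ i, ∑ j, ∑ k, (h i j - h i k) * (x i j - x i k) =
      ∑ i, ∑ j, ∑ k, (h i j - h i k) ^ 2 := by
    rw [hh, sum_harmonicExt_mul hx fun i => rfl, sum_harmonicExt_sq]
  simp only [hexpand, Finset.sum_add_distrib, Finset.sum_sub_distrib, ← Finset.mul_sum,
    horth] at hnonneg
  linarith

end Simplex

namespace Gasket

/-! ### Self-similarity and monotonicity of the energy -/

section Energy

variable {N : ℕ} {p : Fin N → Space N}

open Classical in
/-- The pairs of distinct points of `V_m` in a common cell of level `m`, that is, the oriented
edges of the graph that carries the `m`-energy. -/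
def edges (p : Fin N → Space N) (m : ℕ) : Finset (gasket p × gasket p) :=
  (vertices p m ×ˢ vertices p m).filter fun z => SameCell p m z.1 z.2 ∧ z.1 ≠ z.2

theorem mem_edges {m : ℕ} {z : gasket p × gasket p} :
    z ∈ edges p m ↔
      (z.1 ∈ vertices p m ∧ z.2 ∈ vertices p m) ∧ SameCell p m z.1 z.2 ∧ z.1 ≠ z.2 := by
  simp only [edges, Finset.mem_filter, Finset.mem_product]

theorem energyAt_eq_sum_edges (m : ℕ) (u : gasket p → ℝ) :
    energyAt p m u =
      (1 / 2) * (((N : ℝ) + 2) / N) ^ m * ∑ z ∈ edges p m, (u z.1 - u z.2) ^ 2 := by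
  classical
  rw [energyAt, edges, Finset.sum_filter, Finset.sum_product]
  congr 1
  refine Finset.sum_congr rfl fun x _ => Finset.sum_congr rfl fun y _ => ?_
  rcases eq_or_ne x y with rfl | h
  · simp
  · exact if_congr (and_iff_left h).symm rfl rfl

theorem energyAt_nonneg (m : ℕ) (u : gasket p → ℝ) : 0 ≤ energyAt p m u := by
  rw [energyAt_eq_sum_edges]
  positivity

theorem IsUnitSimplex.energyAt_zero (hp : IsUnitSimplex p) (u : gasket p → ℝ) :
    energyAt p 0 u = 1 / 2 * ∑ i, ∑ j, (u (bdry p i) - u (bdry p j)) ^ 2 := by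
  classical
  simp only [energyAt, vertices_zero, sameCell_zero, if_true, pow_zero, mul_one,
    Finset.sum_image hp.bdry_injective.injOn]

open Classical in
theorem IsUnitSimplex.edges_succ (hp : IsUnitSimplex p) (m : ℕ) :
    edges p (m + 1) = Finset.univ.biUnion fun i =>
      (edges p m).image (Prod.map (cellMap p i) (cellMap p i)) := by
  ext ⟨x, y⟩
  simp only [Finset.mem_biUnion, Finset.mem_univ, true_and, Finset.mem_image, Prod.exists,
    Prod.map_apply, Prod.mk.injEq]
  constructor
  · intro hxy
    obtain ⟨hvert, hcell, hne⟩ := mem_edges.1 hxy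
    obtain ⟨i, x, y, hcell', rfl, rfl⟩ := sameCell_succ_iff.1 hcell
    exact ⟨i, x, y, mem_edges.2 ⟨hvert.imp hp.cellMap_mem_vertices.1 hp.cellMap_mem_vertices.1,
      hcell', ne_of_apply_ne (cellMap p i) hne⟩, rfl, rfl⟩
  · rintro ⟨i, x, y, hxy, rfl, rfl⟩
    obtain ⟨hvert, hcell, hne⟩ := mem_edges.1 hxy
    exact mem_edges.2 ⟨hvert.imp hp.cellMap_mem_vertices.2 hp.cellMap_mem_vertices.2,
      sameCell_succ_iff.2 ⟨i, x, y, hcell, rfl, rfl⟩, (cellMap_injective i).ne hne⟩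

-- Two cells of level one meet in one point at most, and so have no edge in common.
open Classical in
theorem IsUnitSimplex.pairwiseDisjoint_image_edges (hp : IsUnitSimplex p) (m : ℕ) :
    (univ : Set (Fin N)).PairwiseDisjoint fun i =>
      (edges p m).image (Prod.map (cellMap p i) (cellMap p i)) := by
  intro i _ j _ hij
  refine Finset.disjoint_left.2 fun z hi hj => ?_
  obtain ⟨⟨x, y⟩, hxy, rfl⟩ := Finset.mem_image.1 hi
  obtain ⟨⟨x', y'⟩, -, h⟩ := Finset.mem_image.1 hj
  obtain ⟨hx, hy⟩ := Prod.ext_iff.1 h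
  exact (mem_edges.1 hxy).2.2 ((hp.eq_bdry_of_cellMap_eq hij hx.symm).trans
    (hp.eq_bdry_of_cellMap_eq hij hy.symm).symm)

theorem IsUnitSimplex.energyAt_succ (hp : IsUnitSimplex p) (m : ℕ) (u : gasket p → ℝ) :
    energyAt p (m + 1) u = ((N : ℝ) + 2) / N * ∑ i, energyAt p m (u ∘ cellMap p i) := by
  classical
  have hinj : ∀ i, Function.Injective (Prod.map (cellMap p i) (cellMap p i)) :=
    fun i => (cellMap_injective i).prodMap (cellMap_injective i)
  have hsum : ∑ z ∈ edges p (m + 1), (u z.1 - u z.2) ^ 2 =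
      ∑ i, ∑ z ∈ edges p m, (u (cellMap p i z.1) - u (cellMap p i z.2)) ^ 2 := by
    rw [hp.edges_succ, Finset.sum_biUnion (by
      simpa only [Finset.coe_univ] using hp.pairwiseDisjoint_image_edges m)]
    simp only [Finset.sum_image (hinj _).injOn, Prod.map_fst, Prod.map_snd]
  simp only [energyAt_eq_sum_edges, hsum, ← Finset.mul_sum, Function.comp_apply]
  ring

theorem IsUnitSimplex.energyAt_zero_le_one (hp : IsUnitSimplex p) (u : gasket p → ℝ) :
    energyAt p 0 u ≤ energyAt p 1 u := by
  rcases Nat.eq_zero_or_pos N with rfl | hN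
  · rw [hp.energyAt_zero, Finset.univ_eq_empty, Finset.sum_empty, mul_zero]
    exact energyAt_nonneg 1 u
  have hsimplex := (sum_harmonicExt_sq _).symm.trans_le (sum_harmonicExt_sq_le
    (x := fun i j => u (cellMap p i (bdry p j))) fun i j => by rw [cellMap_bdry_comm])
  simp only [cellMap_bdry_self] at hsimplex
  rw [hp.energyAt_succ]
  simp only [hp.energyAt_zero, Function.comp_apply, ← Finset.mul_sum]
  rw [div_mul_eq_mul_div, div_le_iff₀ (by positivity)] at hsimplex
  rw [div_mul_eq_mul_div ((N : ℝ) + 2), le_div_iff₀ (Nat.cast_pos.2 hN)]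
  linarith

theorem IsUnitSimplex.energyAt_mono (hp : IsUnitSimplex p) (u : gasket p → ℝ) :
    Monotone fun m => energyAt p m u := by
  refine monotone_nat_of_le_succ fun m => ?_
  induction m generalizing u with
  | zero => exact hp.energyAt_zero_le_one u
  | succ m ih =>
    rw [hp.energyAt_succ, hp.energyAt_succ (m + 1)]
    gcongr
    exact ih _

theorem IsUnitSimplex.tendsto_energyAt (hp : IsUnitSimplex p) (u : gasket p → ℝ) :
    Tendsto (fun m => ENNReal.ofReal (energyAt p m u)) atTop (𝓝 (energy p u)) := by
  have hmono : Monotone fun m => ENNReal.ofReal (energyAt p m u) :=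
    ENNReal.ofReal_mono.comp (hp.energyAt_mono u)
  have hlim := tendsto_atTop_iSup hmono
  rwa [energy, hlim.liminf_eq]

theorem IsUnitSimplex.energy_add_energy_le (hp : IsUnitSimplex p) {a b u v : gasket p → ℝ}
    (h : ∀ x y, (a x - a y) ^ 2 + (b x - b y) ^ 2 ≤ (u x - u y) ^ 2 + (v x - v y) ^ 2) :
    energy p a + energy p b ≤ energy p u + energy p v := by
  refine le_of_tendsto_of_tendsto' ((hp.tendsto_energyAt a).add (hp.tendsto_energyAt b))
    ((hp.tendsto_energyAt u).add (hp.tendsto_energyAt v)) fun m => ?_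
  simp only [← ENNReal.ofReal_add, energyAt_nonneg]
  refine ENNReal.ofReal_le_ofReal ?_
  simp only [energyAt_eq_sum_edges, ← mul_add, ← Finset.sum_add_distrib]
  exact mul_le_mul_of_nonneg_left (Finset.sum_le_sum fun z _ => h z.1 z.2) (by positivity)

theorem energy_lt_top_of_bound {u : gasket p → ℝ} {C : ℝ} (h : ∀ m, energyAt p m u ≤ C) :
    energy p u < ∞ := by
  refine lt_of_le_of_lt ?_ (ENNReal.ofReal_lt_top (r := C))
  refine liminf_le_of_le (by isBoundedDefault) fun b hb => ?_
  obtain ⟨m, hm⟩ := hb.exists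
  exact hm.trans (ENNReal.ofReal_le_ofReal (h m))

end Energy

end Gasket

section Simplex

variable {N : ℕ} {c : Fin N → ℝ}

theorem harmonicExt_mem_Icc {a b : ℝ} (hc : ∀ i, c i ∈ Icc a b) (i j : Fin N) :
    harmonicExt c i j ∈ Icc a b := by
  rcases eq_or_ne i j with rfl | hij
  · exact (harmonicExt_self c i).symm ▸ hc i
  have hlower : N * a ≤ ∑ k, c k := by
    simpa using Finset.card_nsmul_le_sum Finset.univ c a fun k _ => (hc k).1
  have hupper : ∑ k, c k ≤ N * b := by
    simpa using Finset.sum_le_card_nsmul Finset.univ c b fun k _ => (hc k).2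
  rw [harmonicExt, if_neg hij, mem_Icc, le_div_iff₀ (by positivity), div_le_iff₀ (by positivity)]
  constructor <;> linarith [(hc i).1, (hc i).2, (hc j).1, (hc j).2]

theorem abs_harmonicExt_sub_le_of_ne {D : ℝ} (hc : ∀ i j, |c i - c j| ≤ D) {i j : Fin N}
    (hij : i ≠ j) : |harmonicExt c i j - c i| ≤ N / (N + 2) * D := by
  have hsum : |∑ k, (c k - c i)| ≤ (N - 1) * D := by
    rw [← Finset.add_sum_erase _ _ (Finset.mem_univ i), sub_self, zero_add]
    refine (Finset.abs_sum_le_sum_abs _ _).trans ?_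
    refine (Finset.sum_le_card_nsmul _ _ D fun k _ => hc k i).trans_eq ?_
    rw [Finset.card_erase_of_mem (Finset.mem_univ i), Finset.card_univ, Fintype.card_fin,
      nsmul_eq_mul, Nat.cast_pred i.pos]
  have heq : harmonicExt c i j - c i = (c j - c i + ∑ k, (c k - c i)) / (N + 2) := by
    rw [harmonicExt, if_neg hij, Finset.sum_sub_distrib, Finset.sum_const, Finset.card_univ,
      Fintype.card_fin, nsmul_eq_mul]
    field_simp
    ring
  rw [heq, abs_div, abs_of_pos (by positivity : (0 : ℝ) < N + 2), div_mul_eq_mul_div]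
  gcongr
  linarith [abs_add_le (c j - c i) (∑ k, (c k - c i)), hc j i]

theorem abs_harmonicExt_sub_le {D : ℝ} (hc : ∀ i j, |c i - c j| ≤ D) (i j k : Fin N) :
    |harmonicExt c i j - harmonicExt c i k| ≤ N / (N + 2) * D := by
  have hD : 0 ≤ D := (abs_nonneg _).trans (hc i i)
  have hN : (1 : ℝ) ≤ N := Nat.one_le_cast.2 i.pos
  rcases eq_or_ne i j with rfl | hj <;> rcases eq_or_ne i k with rfl | hk
  · rw [sub_self, abs_zero]
    positivity
  · rw [harmonicExt_self, abs_sub_comm]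
    exact abs_harmonicExt_sub_le_of_ne hc hk
  · rw [harmonicExt_self]
    exact abs_harmonicExt_sub_le_of_ne hc hj
  · have heq : harmonicExt c i j - harmonicExt c i k = (c j - c k) / (N + 2) := by
      rw [harmonicExt, harmonicExt, if_neg hj, if_neg hk]
      ring
    rw [heq, abs_div, abs_of_pos (by positivity : (0 : ℝ) < N + 2), div_mul_eq_mul_div]
    gcongr
    nlinarith [hc j k]

end Simplex

namespace Gasket

/-! ### Gluing, harmonic functions and harmonic splines -/

section Harmonic

variable {N : ℕ} {p : Fin N → Space N}

theorem IsUnitSimplex.exists_glue (hp : IsUnitSimplex p) {φ : Fin N → C(gasket p, ℝ)}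
    (hφ : ∀ i j, φ i (bdry p j) = φ j (bdry p i)) :
    ∃ u : C(gasket p, ℝ), ∀ i x, u (cellMap p i x) = φ i x := by
  have := hp.compactSpace_gasket
  let π : C(Fin N × gasket p, gasket p) :=
    ⟨fun z => cellMap p z.1 z.2, continuous_prod_of_discrete_left.2 continuous_cellMap⟩
  let g : C(Fin N × gasket p, ℝ) :=
    ⟨fun z => φ z.1 z.2, continuous_prod_of_discrete_left.2 fun i => (φ i).continuous⟩
  have hsurj : Function.Surjective π := fun x =>
    let ⟨i, y, h⟩ := hp.exists_cellMap_eq x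
    ⟨(i, y), h⟩
  have hquot : Topology.IsQuotientMap π :=
    π.continuous.isClosedMap.isQuotientMap π.continuous hsurj
  have hfac : Function.FactorsThrough g π := by
    rintro ⟨i, x⟩ ⟨j, y⟩ (h : cellMap p i x = cellMap p j y)
    change φ i x = φ j y
    rcases eq_or_ne i j with rfl | hij
    · rw [cellMap_injective i h]
    · rw [hp.eq_bdry_of_cellMap_eq hij h, hp.eq_bdry_of_cellMap_eq hij.symm h.symm, hφ]
  exact ⟨hquot.lift g hfac, fun i x => DFunLike.congr_fun (hquot.lift_comp g hfac) (i, x)⟩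

open Classical in
/-- The continuous function whose pullbacks to the cells of level one are `φ i`, and the junk
value `0` if the functions `φ i` do not fit together. -/
def glue (φ : Fin N → C(gasket p, ℝ)) : C(gasket p, ℝ) :=
  if h : ∃ u : C(gasket p, ℝ), ∀ i x, u (cellMap p i x) = φ i x then h.choose else 0

theorem IsUnitSimplex.glue_cellMap (hp : IsUnitSimplex p) {φ : Fin N → C(gasket p, ℝ)}
    (hφ : ∀ i j, φ i (bdry p j) = φ j (bdry p i)) (i : Fin N) (x : gasket p) :
    glue φ (cellMap p i x) = φ i x := by
  have h := hp.exists_glue hφ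
  rw [glue, dif_pos h]
  exact h.choose_spec i x

theorem IsUnitSimplex.energyAt_glue_le (hp : IsUnitSimplex p) {φ : Fin N → C(gasket p, ℝ)}
    (hφ : ∀ i j, φ i (bdry p j) = φ j (bdry p i)) {C : Fin N → ℝ}
    (hC : ∀ i m, energyAt p m (φ i) ≤ C i) (m : ℕ) :
    energyAt p m (glue φ) ≤ ((N : ℝ) + 2) / N * ∑ i, C i := by
  refine (hp.energyAt_mono _ m.le_succ).trans ?_
  have hpull : ∀ i, (glue φ : gasket p → ℝ) ∘ cellMap p i = φ i :=
    fun i => funext (hp.glue_cellMap hφ i)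
  simp only [Nat.succ_eq_add_one, hp.energyAt_succ, hpull]
  gcongr with i
  exact hC i m

/-- Approximations of the harmonic function with boundary values `c`: affine on the cells of level
`n`, with the values at their corners obtained by repeated harmonic extension. -/
def harmonicSeq (p : Fin N → Space N) : ℕ → (Fin N → ℝ) → C(gasket p, ℝ)
  | 0, c => ⟨fun x => ∑ i, bary p i x * c i, continuous_finsetSum _ fun i _ =>
      ((continuous_bary i).comp continuous_subtype_val).mul continuous_const⟩
  | n + 1, c => glue fun i => harmonicSeq p n (harmonicExt c i)

theorem IsUnitSimplex.harmonicSeq_bdry (hp : IsUnitSimplex p) (n : ℕ) (c : Fin N → ℝ)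
    (j : Fin N) : harmonicSeq p n c (bdry p j) = c j := by
  induction n generalizing c j with
  | zero => simp [harmonicSeq, bdry, hp.bary_vertex]
  | succ n ih =>
    rw [harmonicSeq, ← cellMap_bdry_self j, hp.glue_cellMap, ih, harmonicExt_self]
    intro i j
    rw [ih, ih, harmonicExt_comm]

theorem IsUnitSimplex.harmonicSeq_succ_cellMap (hp : IsUnitSimplex p) (n : ℕ) (c : Fin N → ℝ)
    (i : Fin N) (x : gasket p) :
    harmonicSeq p (n + 1) c (cellMap p i x) = harmonicSeq p n (harmonicExt c i) x := by
  rw [harmonicSeq, hp.glue_cellMap]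
  intro i j
  rw [hp.harmonicSeq_bdry, hp.harmonicSeq_bdry, harmonicExt_comm]

theorem IsUnitSimplex.harmonicSeq_mem_Icc (hp : IsUnitSimplex p) (n : ℕ) {c : Fin N → ℝ}
    {a b : ℝ} (hc : ∀ i, c i ∈ Icc a b) (x : gasket p) : harmonicSeq p n c x ∈ Icc a b := by
  obtain ⟨i₀, -⟩ := hp.exists_cellMap_eq x
  induction n generalizing c x with
  | zero =>
    exact (convex_Icc a b).sum_mem (fun i _ => hp.bary_nonneg x.2 i) (sum_bary i₀.pos.ne' _)
      fun i _ => hc i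
  | succ n ih =>
    obtain ⟨i, y, rfl⟩ := hp.exists_cellMap_eq x
    rw [hp.harmonicSeq_succ_cellMap]
    exact ih (harmonicExt_mem_Icc hc i) y

theorem IsUnitSimplex.abs_harmonicSeq_succ_sub_le (hp : IsUnitSimplex p) (n : ℕ)
    {c : Fin N → ℝ} {D : ℝ} (hc : ∀ i j, |c i - c j| ≤ D) (x : gasket p) :
    |harmonicSeq p n c x - harmonicSeq p (n + 1) c x| ≤ 2 * D * (N / (N + 2) : ℝ) ^ n := by
  obtain ⟨i, y, rfl⟩ := hp.exists_cellMap_eq x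
  induction n generalizing c D i y with
  | zero =>
    have hrange : ∀ j, c j ∈ Icc (c i - D) (c i + D) := fun j => by
      have := abs_le.1 (hc j i)
      constructor <;> linarith
    have h₀ := hp.harmonicSeq_mem_Icc 0 hrange (cellMap p i y)
    have h₁ := hp.harmonicSeq_mem_Icc 1 hrange (cellMap p i y)
    rw [abs_le, pow_zero]
    constructor <;> linarith [h₀.1, h₀.2, h₁.1, h₁.2]
  | succ n ih =>
    rw [hp.harmonicSeq_succ_cellMap, hp.harmonicSeq_succ_cellMap]
    obtain ⟨j, z, rfl⟩ := hp.exists_cellMap_eq y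
    refine (ih (abs_harmonicExt_sub_le hc i) j z).trans_eq ?_
    ring

theorem IsUnitSimplex.exists_tendsto_harmonicSeq (hp : IsUnitSimplex p) (c : Fin N → ℝ) :
    ∃ h : C(gasket p, ℝ), Tendsto (fun n => harmonicSeq p n c) atTop (𝓝 h) := by
  have := hp.compactSpace_gasket
  set D := ∑ k, |c k|
  have hle : ∀ i, |c i| ≤ D := fun i =>
    Finset.single_le_sum (f := fun k => |c k|) (fun _ _ => abs_nonneg _) (Finset.mem_univ i)
  have hc : ∀ i j, |c i - c j| ≤ D + D := fun i j =>
    (abs_sub _ _).trans (add_le_add (hle i) (hle j))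
  have hratio : (N / (N + 2) : ℝ) < 1 := by
    rw [div_lt_one (by positivity)]
    linarith
  refine cauchySeq_tendsto_of_complete (cauchySeq_of_le_geometric _ (2 * (D + D)) hratio
    fun n => (ContinuousMap.dist_le (by positivity)).2 fun x => ?_)
  rw [Real.dist_eq]
  exact hp.abs_harmonicSeq_succ_sub_le n hc x

/-- The harmonic function on the gasket with boundary values `c`. -/
def harmonic (p : Fin N → Space N) (c : Fin N → ℝ) : C(gasket p, ℝ) :=
  limUnder atTop fun n => harmonicSeq p n c

theorem IsUnitSimplex.tendsto_harmonicSeq_apply (hp : IsUnitSimplex p) (c : Fin N → ℝ)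
    (x : gasket p) : Tendsto (fun n => harmonicSeq p n c x) atTop (𝓝 (harmonic p c x)) :=
  ((continuous_eval_const x).tendsto (harmonic p c)).comp
    (tendsto_nhds_limUnder (hp.exists_tendsto_harmonicSeq c))

theorem IsUnitSimplex.harmonic_bdry (hp : IsUnitSimplex p) (c : Fin N → ℝ) (j : Fin N) :
    harmonic p c (bdry p j) = c j := by
  refine tendsto_nhds_unique (hp.tendsto_harmonicSeq_apply c _) ?_
  simp only [hp.harmonicSeq_bdry]
  exact tendsto_const_nhds

theorem IsUnitSimplex.harmonic_cellMap (hp : IsUnitSimplex p) (c : Fin N → ℝ) (i : Fin N)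
    (x : gasket p) : harmonic p c (cellMap p i x) = harmonic p (harmonicExt c i) x :=
  tendsto_nhds_unique ((hp.tendsto_harmonicSeq_apply c _).comp (tendsto_add_atTop_nat 1))
    ((hp.tendsto_harmonicSeq_apply (harmonicExt c i) x).congr fun n =>
      (hp.harmonicSeq_succ_cellMap n c i x).symm)

theorem IsUnitSimplex.harmonic_mem_Icc (hp : IsUnitSimplex p) {c : Fin N → ℝ} {a b : ℝ}
    (hc : ∀ i, c i ∈ Icc a b) (x : gasket p) : harmonic p c x ∈ Icc a b :=
  isClosed_Icc.mem_of_tendsto (hp.tendsto_harmonicSeq_apply c x)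
    (Eventually.of_forall fun n => hp.harmonicSeq_mem_Icc n hc x)

theorem IsUnitSimplex.energyAt_harmonic (hp : IsUnitSimplex p) (m : ℕ) (c : Fin N → ℝ) :
    energyAt p m (harmonic p c) = 1 / 2 * ∑ i, ∑ j, (c i - c j) ^ 2 := by
  induction m generalizing c with
  | zero => simp only [hp.energyAt_zero, hp.harmonic_bdry]
  | succ m ih =>
    have hpull : ∀ i, (harmonic p c : gasket p → ℝ) ∘ cellMap p i = harmonic p (harmonicExt c i) :=
      fun i => funext (hp.harmonic_cellMap c i)
    simp only [hp.energyAt_succ, hpull, ih]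
    rw [← Finset.mul_sum, sum_harmonicExt_sq]
    rcases Nat.eq_zero_or_pos N with rfl | hN
    · simp
    · have : (0 : ℝ) < N := Nat.cast_pos.2 hN
      field_simp

/-- `u` is an approximation of `f` up to `ε` by a function of finite energy that has the same
boundary values; the energy is finite in the form of a bound for all `m`-energies. -/
def IsEnergyApprox (ε : ℝ) (f u : C(gasket p, ℝ)) : Prop :=
  (∃ C, ∀ k, energyAt p k u ≤ C) ∧ (∀ j, u (bdry p j) = f (bdry p j)) ∧ ∀ x, |u x - f x| ≤ ε

theorem IsUnitSimplex.isEnergyApprox_harmonic (hp : IsUnitSimplex p) {ε : ℝ}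
    {f : C(gasket p, ℝ)} (hf : ∀ x y, |f x - f y| ≤ ε) :
    IsEnergyApprox ε f (harmonic p fun i => f (bdry p i)) := by
  refine ⟨⟨_, fun k => (hp.energyAt_harmonic k _).le⟩, hp.harmonic_bdry _, fun x => ?_⟩
  have hrange : ∀ i, f (bdry p i) ∈ Icc (f x - ε) (f x + ε) := fun i => by
    have := abs_le.1 (hf (bdry p i) x)
    constructor <;> linarith
  have := hp.harmonic_mem_Icc hrange x
  exact abs_le.2 ⟨by linarith [this.1], by linarith [this.2]⟩

theorem IsUnitSimplex.isEnergyApprox_glue (hp : IsUnitSimplex p) {ε : ℝ} {f : C(gasket p, ℝ)}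
    {φ : Fin N → C(gasket p, ℝ)}
    (hφ : ∀ i, IsEnergyApprox ε (f.comp ⟨cellMap p i, continuous_cellMap i⟩) (φ i)) :
    IsEnergyApprox ε f (glue φ) := by
  choose hC hbdry hnear using hφ
  choose C hC using hC
  have hfit : ∀ i j, φ i (bdry p j) = φ j (bdry p i) := fun i j => by
    simp only [hbdry, ContinuousMap.comp_apply, ContinuousMap.coe_mk, cellMap_bdry_comm i j]
  refine ⟨⟨_, hp.energyAt_glue_le hfit hC⟩, fun j => ?_, fun x => ?_⟩
  · rw [← cellMap_bdry_self j, hp.glue_cellMap hfit, hbdry]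
    rfl
  · obtain ⟨i, y, rfl⟩ := hp.exists_cellMap_eq x
    rw [hp.glue_cellMap hfit]
    exact hnear i y

theorem IsUnitSimplex.exists_isEnergyApprox_of_dist_le (hp : IsUnitSimplex p) {D : ℝ}
    (hD : ∀ x y : gasket p, dist x y ≤ D) {ε : ℝ} (m : ℕ) (f : C(gasket p, ℝ))
    (hf : ∀ x y, dist x y ≤ D / 2 ^ m → |f x - f y| ≤ ε) : ∃ u, IsEnergyApprox ε f u := by
  induction m generalizing f with
  | zero => exact ⟨_, hp.isEnergyApprox_harmonic fun x y => hf x y (by simpa using hD x y)⟩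
  | succ m ih =>
    choose φ hφ using fun i => ih (f.comp ⟨cellMap p i, continuous_cellMap i⟩) fun x y hxy =>
      hf (cellMap p i x) (cellMap p i y) (by
        rw [dist_cellMap, pow_succ, ← div_div]
        linarith)
    exact ⟨_, hp.isEnergyApprox_glue hφ⟩

theorem IsUnitSimplex.exists_sobolev_near (hp : IsUnitSimplex p) (f : C(gasket p, ℝ)) {ε : ℝ}
    (hε : 0 < ε) :
    ∃ u ∈ sobolev p, (∀ j, u (bdry p j) = f (bdry p j)) ∧ ∀ x, |u x - f x| ≤ ε := by
  have := hp.compactSpace_gasket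
  obtain ⟨δ, hδ, hf⟩ := Metric.uniformContinuous_iff.1
    (CompactSpace.uniformContinuous_of_continuous f.continuous) ε hε
  have hD : ∀ x y : gasket p, dist x y ≤ Metric.diam (univ : Set (gasket p)) := fun x y =>
    Metric.dist_le_diam_of_mem isCompact_univ.isBounded (mem_univ x) (mem_univ y)
  have hlim : Tendsto (fun m : ℕ => Metric.diam (univ : Set (gasket p)) / 2 ^ m) atTop (𝓝 0) :=
    tendsto_const_nhds.div_atTop (tendsto_pow_atTop_atTop_of_one_lt one_lt_two)
  obtain ⟨m, hm⟩ := (hlim.eventually (gt_mem_nhds hδ)).exists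
  obtain ⟨u, ⟨C, hC⟩, hbdry, hnear⟩ := hp.exists_isEnergyApprox_of_dist_le hD m f
    fun x y hxy => (hf (hxy.trans_lt hm)).le
  exact ⟨u, energy_lt_top_of_bound hC, hbdry, hnear⟩

end Harmonic

end Gasket

/-! ### Density of the effective domain -/

section ContinuousDense

variable {X : Type*} [MeasurableSpace X] {μ : Measure X} [IsFiniteMeasure μ]
  {q : ℝ≥0∞} [Fact (1 ≤ q)]

theorem tendsto_toLp_of_bounded [TopologicalSpace X] [CompactSpace X] [BorelSpace X] (hq : q ≠ ∞)
    {F : ℕ → C(X, ℝ)} {f : C(X, ℝ)} {C : ℝ} (hC : ∀ n x, ‖F n x‖ ≤ C)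
    (hlim : ∀ᵐ x ∂μ, Tendsto (fun n => F n x) atTop (𝓝 (f x))) :
    Tendsto (fun n => ContinuousMap.toLp q μ ℝ (F n)) atTop (𝓝 (ContinuousMap.toLp q μ ℝ f)) := by
  have hmeas : ∀ n, AEStronglyMeasurable (F n) μ := fun n => (F n).continuous.aestronglyMeasurable
  have hunif : UnifIntegrable (fun n => F n) q μ := by
    refine unifIntegrable_of Fact.out hq hmeas fun ε _ => ⟨C.toNNReal + 1, fun n => ?_⟩
    have hlt : ∀ x, ‖F n x‖₊ < C.toNNReal + 1 := fun x =>
      (NNReal.le_toNNReal_of_coe_le (hC n x)).trans_lt (lt_add_one _)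
    simp [(hlt _).not_ge]
  have hf : MemLp f q μ := (Lp.memLp _).ae_eq (ContinuousMap.coeFn_toLp (p := q) (𝕜 := ℝ) μ f)
  refine Lp.tendsto_Lp_iff_tendsto_eLpNorm' _ _ |>.2 ?_
  refine (tendsto_Lp_finite_of_tendsto_ae Fact.out hq hmeas hf hunif hlim).congr fun n => ?_
  exact eLpNorm_congr_ae
    ((ContinuousMap.coeFn_toLp μ (F n)).sub (ContinuousMap.coeFn_toLp μ f)).symm

theorem dense_toLp_image_vanishing [PseudoMetricSpace X] [CompactSpace X] [BorelSpace X]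
    (hq : q ≠ ∞) {K : Set X} (hK : IsClosed K) (hμK : μ K = 0) :
    Dense (ContinuousMap.toLp q μ ℝ '' {f : C(X, ℝ) | ∀ x ∈ K, f x = 0}) := by
  rw [← dense_closure]
  refine (ContinuousMap.toLp_denseRange ℝ μ ℝ hq).mono ?_
  rintro _ ⟨f, rfl⟩
  obtain ⟨δ, -, hδ, hδ_lim⟩ := exists_seq_strictAnti_tendsto (0 : ℝ)
  let χ (n : ℕ) : C(X, ℝ) := ⟨fun x => 1 - thickenedIndicator (hδ n) K x, by fun_prop⟩
  have hχ : ∀ n x, ‖χ n x‖ ≤ 1 := fun n x => by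
    have hle : (thickenedIndicator (hδ n) K x : ℝ) ≤ 1 :=
      mod_cast thickenedIndicator_le_one (hδ n) K x
    exact (Real.norm_of_nonneg (sub_nonneg.2 hle)).trans_le (sub_le_self _ NNReal.zero_le_coe)
  refine mem_closure_of_tendsto (tendsto_toLp_of_bounded hq (F := fun n => χ n * f) (C := ‖f‖)
    (fun n x => ?_) ?_) (Eventually.of_forall fun n => mem_image_of_mem _ fun x hx => ?_)
  · rw [ContinuousMap.mul_apply, norm_mul]
    exact (mul_le_mul (hχ n x) (f.norm_coe_le_norm x) (norm_nonneg _) zero_le_one).trans_eq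
      (one_mul _)
  · filter_upwards [compl_mem_ae_iff.2 hμK] with x hx
    have hlim := tendsto_pi_nhds.1 (thickenedIndicator_tendsto_indicator_closure hδ hδ_lim K) x
    rw [hK.closure_eq, indicator_of_notMem hx] at hlim
    simpa [χ] using ((NNReal.tendsto_coe.2 hlim).const_sub 1).mul_const (f x)
  · have hzero : χ n x = 0 := by
      rw [ContinuousMap.coe_mk, thickenedIndicator_one (hδ n) K hx, NNReal.coe_one, sub_self]
    rw [ContinuousMap.mul_apply, hzero, zero_mul]

end ContinuousDense

namespace Gasket

section Perturbed

variable {N : ℕ} {p : Fin N → Space N} {μ : Measure (gasket p)} {B : Fin N → ℝ → ℝ≥0∞}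

theorem perturbedEnergy_le {f : Lp ℝ 2 μ} {u : C(gasket p, ℝ)} (hu : u ∈ sobolev p)
    (huf : u =ᵐ[μ] f) : perturbedEnergy p μ B f ≤ energy p u + ∑ i, B i (u (bdry p i)) :=
  iInf₂_le u ⟨hu, huf⟩

theorem IsUnitSimplex.dense_effDomain (hp : IsUnitSimplex p) [IsFiniteMeasure μ]
    (hμ : μ (range (bdry p)) = 0) (hB : ∀ i, B i 0 = 0) :
    Dense (effDomain (perturbedEnergy p μ B)) := by
  have := hp.compactSpace_gasket
  rw [← dense_closure]
  refine (dense_toLp_image_vanishing (by norm_num) (finite_range _).isClosed hμ).mono ?_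
  rintro _ ⟨f, hf, rfl⟩
  choose u hu hbdry hnear using fun n : ℕ =>
    hp.exists_sobolev_near f (Nat.one_div_pos_of_nat (α := ℝ) (n := n))
  have hlim : Tendsto u atTop (𝓝 f) := by
    refine tendsto_iff_dist_tendsto_zero.2 <| squeeze_zero (fun _ => dist_nonneg)
      (fun n => (ContinuousMap.dist_le Nat.one_div_pos_of_nat.le).2 (hnear n))
      tendsto_one_div_add_atTop_nhds_zero_nat
  refine mem_closure_of_tendsto
    (((ContinuousMap.toLp 2 μ ℝ).continuous.tendsto f).comp hlim) (Eventually.of_forall fun n => ?_)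
  refine (perturbedEnergy_le (hu n) (ContinuousMap.coeFn_toLp (𝕜 := ℝ) μ (u n)).symm).trans_lt ?_
  have hvanish : ∀ j, u n (bdry p j) = 0 := fun j => (hbdry n j).trans (hf _ (mem_range_self j))
  simp only [hvanish, hB, Finset.sum_const_zero, add_zero]
  exact hu n

/-! ### Truncation -/

theorem exists_representative [μ.IsOpenPosMeasure] {f : Lp ℝ 2 μ}
    (hf : perturbedEnergy p μ B f < ∞) :
    ∃ u ∈ sobolev p, u =ᵐ[μ] f ∧
      perturbedEnergy p μ B f = energy p u + ∑ i, B i (u (bdry p i)) := by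
  obtain ⟨u, hlt⟩ := iInf_lt_iff.1 hf
  obtain ⟨⟨hu, huf⟩, -⟩ := iInf_lt_iff.1 hlt
  refine ⟨u, hu, huf, le_antisymm (perturbedEnergy_le hu huf) (le_iInf₂ fun v hv => ?_)⟩
  have huv : u = v := DFunLike.coe_injective
    ((u.continuous.ae_eq_iff_eq μ v.continuous).1 (huf.trans hv.2.symm))
  rw [huv]

theorem truncation_sq_le (k s t s' t' : ℝ) :
    (s - (s - t - k)⁺ - (s' - (s' - t' - k)⁺)) ^ 2
      + (t + (s - t - k)⁺ - (t' + (s' - t' - k)⁺)) ^ 2 ≤ (s - s') ^ 2 + (t - t') ^ 2 := by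
  have key : ∀ d d' : ℝ, (d⁺ - d'⁺) ^ 2 ≤ (d⁺ - d'⁺) * (d - d') := fun d d' => by
    rcases le_total d 0 with h | h <;> rcases le_total d' 0 with h' | h' <;>
      simp only [posPart_of_nonneg, posPart_of_nonpos, h, h'] <;> nlinarith
  linarith [key (s - t - k) (s' - t' - k)]

theorem posPart_sub_const_ae_eq [IsFiniteMeasure μ] {f g : Lp ℝ 2 μ} {u v : gasket p → ℝ}
    (hu : u =ᵐ[μ] f) (hv : v =ᵐ[μ] g) (k : ℝ) :
    (fun x => (u x - v x - k)⁺) =ᵐ[μ] ((f - g - Lp.const 2 μ k)⁺ : Lp ℝ 2 μ) := by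
  filter_upwards [hu, hv, Lp.coeFn_sup (f - g - Lp.const 2 μ k) 0,
    Lp.coeFn_sub (f - g) (Lp.const 2 μ k), Lp.coeFn_sub f g, Lp.coeFn_const 2 μ k,
    Lp.coeFn_zero ℝ 2 μ] with x hux hvx hsup hsubk hsub hconst hzero
  rw [posPart_def, posPart_def, hsup, Pi.sup_apply, hsubk, Pi.sub_apply, hsub, Pi.sub_apply,
    hconst, hzero, hux, hvx]
  rfl

theorem IsUnitSimplex.perturbedEnergy_truncation_le (hp : IsUnitSimplex p) [IsFiniteMeasure μ]
    [μ.IsOpenPosMeasure] {B₁ B₂ : Fin N → ℝ → ℝ≥0∞} (k : ℝ) {f g : Lp ℝ 2 μ}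
    (hB : ∀ u v : C(gasket p, ℝ), u =ᵐ[μ] f → v =ᵐ[μ] g → ∀ i,
      B₁ i (u (bdry p i) - (u (bdry p i) - v (bdry p i) - k)⁺)
        + B₂ i (v (bdry p i) + (u (bdry p i) - v (bdry p i) - k)⁺) ≤
      B₁ i (u (bdry p i)) + B₂ i (v (bdry p i))) :
    perturbedEnergy p μ B₁ (f - (f - g - Lp.const 2 μ k)⁺)
      + perturbedEnergy p μ B₂ (g + (f - g - Lp.const 2 μ k)⁺) ≤
      perturbedEnergy p μ B₁ f + perturbedEnergy p μ B₂ g := by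
  rcases eq_or_ne (perturbedEnergy p μ B₁ f) ∞ with hf | hf
  · simp only [hf, top_add, le_top]
  rcases eq_or_ne (perturbedEnergy p μ B₂ g) ∞ with hg | hg
  · simp only [hg, add_top, le_top]
  obtain ⟨u, hu, huf, hWu⟩ := exists_representative hf.lt_top
  obtain ⟨v, hv, hvg, hWv⟩ := exists_representative hg.lt_top
  let w : C(gasket p, ℝ) := ⟨fun x => (u x - v x - k)⁺, by fun_prop⟩
  have hw : w =ᵐ[μ] ((f - g - Lp.const 2 μ k)⁺ : Lp ℝ 2 μ) := posPart_sub_const_ae_eq huf hvg k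
  have henergy : energy p (u - w : C(gasket p, ℝ)) + energy p (v + w : C(gasket p, ℝ)) ≤
      energy p u + energy p v :=
    hp.energy_add_energy_le fun x y => truncation_sq_le k (u x) (v x) (u y) (v y)
  obtain ⟨hu_sub, hv_add⟩ :=
    ENNReal.add_lt_top.1 (henergy.trans_lt (ENNReal.add_lt_top.2 ⟨hu, hv⟩))
  rw [hWu, hWv]
  refine (add_le_add
    (perturbedEnergy_le (u := u - w) hu_sub ((huf.sub hw).trans (Lp.coeFn_sub _ _).symm))
    (perturbedEnergy_le (u := v + w) hv_add ((hvg.add hw).trans (Lp.coeFn_add _ _).symm))).trans ?_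
  rw [add_add_add_comm, add_add_add_comm (energy p u), ← Finset.sum_add_distrib,
    ← Finset.sum_add_distrib]
  exact add_le_add henergy (Finset.sum_le_sum fun i _ => hB u v huf hvg i)

end Perturbed

end Gasket

theorem ConvexEnergy.add_swap_le {E : Type*} [AddCommGroup E] [Module ℝ E] {W : E → ℝ≥0∞}
    (hW : ConvexEnergy W) (u v : E) {a b : ℝ} (ha : 0 ≤ a) (hb : 0 ≤ b) (hab : a + b = 1) :
    W (a • u + b • v) + W (b • u + a • v) ≤ W u + W v := by
  have hsum : ENNReal.ofReal a + ENNReal.ofReal b = 1 := by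
    rw [← ENNReal.ofReal_add ha hb, hab, ENNReal.ofReal_one]
  calc W (a • u + b • v) + W (b • u + a • v)
      ≤ ENNReal.ofReal a * W u + ENNReal.ofReal b * W v
        + (ENNReal.ofReal b * W u + ENNReal.ofReal a * W v) :=
        add_le_add (hW u v a b ha hb hab) (hW u v b a hb ha ((add_comm b a).trans hab))
    _ = (ENNReal.ofReal a + ENNReal.ofReal b) * (W u + W v) := by ring
    _ = W u + W v := by rw [hsum, one_mul]

theorem ConvexEnergy.truncation_le {β : ℝ → ℝ≥0∞} (hβ : ConvexEnergy β) {k : ℝ} (hk : 0 ≤ k)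
    (s t : ℝ) : β (s - (s - t - k)⁺) + β (t + (s - t - k)⁺) ≤ β s + β t := by
  rcases le_or_gt (s - t - k) 0 with h | h
  · rw [posPart_of_nonpos h, sub_zero, add_zero]
  · have hst : 0 < s - t := by linarith
    have hle : k / (s - t) ≤ 1 := (div_le_one hst).2 (by linarith)
    have hswap := hβ.add_swap_le s t (div_nonneg hk hst.le) (sub_nonneg.2 hle) (by ring)
    rw [posPart_of_nonneg h.le]
    convert hswap using 3 <;> simp only [smul_eq_mul] <;> field_simp <;> ring

theorem extSub_coe_coe (a b : ℝ≥0) : extSub a b = ((a - b : ℝ) : EReal) := by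
  rw [extSub, if_neg ENNReal.coe_ne_top, EReal.coe_nnreal_eq_coe_real, EReal.coe_nnreal_eq_coe_real,
    EReal.coe_sub]

theorem extSub_coe_top (a : ℝ≥0) : extSub a ∞ = ⊥ := by
  rw [extSub, if_neg ENNReal.coe_ne_top, EReal.coe_ennreal_top, EReal.sub_top]

theorem extSub_top (b : ℝ≥0∞) : extSub ∞ b = ⊤ := if_pos rfl

theorem extSub_le_extSub {a b a' b' : ℝ≥0∞} (h : extSub a b ≤ extSub a' b') :
    a + b' ≤ a' + b := by
  induction a' with
  | top => rw [top_add]; exact le_top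
  | coe a' =>
  induction b with
  | top => rw [add_top]; exact le_top
  | coe b =>
  induction a with
  | top => induction b' with
    | top => simp [extSub_top, extSub_coe_top] at h
    | coe b' => simp [extSub_top, extSub_coe_coe, -EReal.coe_sub] at h
  | coe a => induction b' with
    | top => simp [extSub_coe_top, extSub_coe_coe, -EReal.coe_sub] at h
    | coe b' =>
      rw [extSub_coe_coe, extSub_coe_coe, EReal.coe_le_coe_iff] at h
      have hreal : (a + b' : ℝ) ≤ a' + b := by linarith
      exact_mod_cast hreal

section GradientFlow

variable {H : Type*} [NormedAddCommGroup H] [InnerProductSpace ℝ H] {W : H → ℝ≥0∞}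

theorem IsGradientFlow.neg {u₀ : H} {u : ℝ≥0 → H} (h : IsGradientFlow W u₀ u) :
    IsGradientFlow (fun f => W (-f)) (-u₀) (fun t => -u t) := by
  obtain ⟨hu, hu₀, g, hg, hug, hsub⟩ := h
  refine ⟨hu.neg, congrArg Neg.neg hu₀, fun t => -g t, fun a b ha hab => (hg a b ha hab).neg,
    fun a b ha hab => ?_, ?_⟩
  · rw [intervalIntegral.integral_neg, ← hug a b ha hab, neg_sub_neg, neg_sub]
  · filter_upwards [hsub] with t ht
    rw [mem_subgradient_iff] at ht ⊢
    simp only [neg_neg]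
    refine ⟨(congrArg W (neg_neg _)).trans_lt ht.1, fun v hv => ?_⟩
    have := ht.2 (-v) hv
    rwa [← neg_add', inner_neg_neg, ← sub_neg_eq_add v] at this

theorem IsGeneratedBy.neg {S : ℝ≥0 → H → H} (hS : IsGeneratedBy W S) :
    IsGeneratedBy (fun f => W (-f)) fun t f => -S t (-f) := fun u₀ hu₀ => by
  have h := (hS (-u₀) (map_mem_closure continuous_neg hu₀ fun _ hf => hf)).neg
  rwa [neg_neg] at h

theorem isGradientFlow_zero (hW : W 0 = 0) : IsGradientFlow W 0 fun _ => 0 :=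
  ⟨continuous_const, rfl, fun _ => 0, fun _ _ _ _ => MemLp.zero, fun _ _ _ _ => by simp,
    Eventually.of_forall fun _ => mem_subgradient_iff.2 ⟨by simp [effDomain, hW], by simp [hW]⟩⟩

end GradientFlow

theorem abs_le_const_iff_eLpNorm_top_le {X : Type*} [MeasurableSpace X] {μ : Measure X}
    [IsFiniteMeasure μ] {q : ℝ≥0∞} {f : Lp ℝ q μ} {k : ℝ} (hk : 0 ≤ k) :
    |f| ≤ Lp.const q μ k ↔ eLpNorm f ∞ μ ≤ ENNReal.ofReal k := by
  have hae : |f| ≤ Lp.const q μ k ↔ ∀ᵐ x ∂μ, ‖f x‖ₑ ≤ ENNReal.ofReal k := by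
    rw [← Lp.coeFn_le]
    refine eventually_congr ?_
    filter_upwards [Lp.coeFn_abs f, Lp.coeFn_const q μ k] with x habs hconst
    rw [habs, hconst, Function.const_apply, Real.enorm_eq_ofReal_abs,
      ENNReal.ofReal_le_ofReal_iff hk]
  rw [hae, eLpNorm_exponent_top]
  exact ⟨essSup_le_of_ae_le _, fun h => ae_le_eLpNormEssSup.mono fun x hx => hx.trans h⟩

namespace Gasket

/-! ### Comparison for the perturbed energies -/

section Perturbed

variable {N : ℕ} {p : Fin N → Space N} {μ : Measure (gasket p)} {B : Fin N → ℝ → ℝ≥0∞}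

theorem nonneg_of_ae_eq [μ.IsOpenPosMeasure] {g : Lp ℝ 2 μ} (hg : 0 ≤ g) {v : C(gasket p, ℝ)}
    (hv : v =ᵐ[μ] g) (x : gasket p) : 0 ≤ v x := by
  have hae : ∀ᵐ y ∂μ, v y ∈ Ici 0 := by
    filter_upwards [hv, (Lp.coeFn_nonneg g).2 hg] with y hvy hgy using hvy.symm ▸ hgy
  exact (isClosed_Ici.preimage v.continuous).closure_subset (Measure.dense_of_ae hae x)

theorem energy_zero : energy p 0 = 0 := by
  simp [energy, energyAt]

theorem perturbedEnergy_zero (hB : ∀ i, B i 0 = 0) : perturbedEnergy p μ B 0 = 0 := by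
  have hmem : (0 : C(gasket p, ℝ)) ∈ sobolev p := energy_zero.trans_lt ENNReal.zero_lt_top
  have hle := perturbedEnergy_le (B := B) hmem (Lp.coeFn_zero ℝ 2 μ).symm
  simpa [energy_zero, hB] using hle

theorem energy_neg (u : gasket p → ℝ) : energy p (-u) = energy p u := by
  have hsq : ∀ x y, (-u x - -u y) ^ 2 = (u x - u y) ^ 2 := fun x y => by ring
  simp only [energy, energyAt, Pi.neg_apply, hsq]

theorem perturbedEnergy_neg_le (f : Lp ℝ 2 μ) :
    perturbedEnergy p μ (fun i s => B i (-s)) (-f) ≤ perturbedEnergy p μ B f := by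
  refine le_iInf₂ fun u hu => ?_
  have hmem : -u ∈ sobolev p := (energy_neg u).trans_lt hu.1
  refine (perturbedEnergy_le hmem (hu.2.neg.trans (Lp.coeFn_neg f).symm)).trans_eq ?_
  simp only [ContinuousMap.coe_neg, energy_neg, Pi.neg_apply, neg_neg]

theorem perturbedEnergy_neg (f : Lp ℝ 2 μ) :
    perturbedEnergy p μ (fun i s => B i (-s)) f = perturbedEnergy p μ B (-f) := by
  apply le_antisymm
  · simpa using perturbedEnergy_neg_le (B := B) (-f)
  · simpa using perturbedEnergy_neg_le (B := fun i s => B i (-s)) f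

end Perturbed

section Flow

variable {N : ℕ} {p : Fin N → Space N} {μ : Measure (gasket p)} [IsFiniteMeasure μ]
  [μ.IsOpenPosMeasure] {B B' : Fin N → ℝ → ℝ≥0∞} {u₀ v₀ : Lp ℝ 2 μ} {u v : ℝ≥0 → Lp ℝ 2 μ}

theorem IsUnitSimplex.flow_le_flow (hp : IsUnitSimplex p)
    (hu : IsGradientFlow (perturbedEnergy p μ B') u₀ u)
    (hv : IsGradientFlow (perturbedEnergy p μ B) v₀ v)
    (h : ∀ (t : ℝ≥0) (f g : C(gasket p, ℝ)), f =ᵐ[μ] u t → g =ᵐ[μ] v t → ∀ i,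
      g (bdry p i) ≤ f (bdry p i) → B' i (g (bdry p i)) + B i (f (bdry p i)) ≤
        B' i (f (bdry p i)) + B i (g (bdry p i)))
    (h₀ : u₀ ≤ v₀) (t : ℝ≥0) : u t ≤ v t := by
  have hflow := hu.sub_le_of_posPart hv (k := Lp.const 2 μ 0) (fun t =>
    hp.perturbedEnergy_truncation_le 0 fun f g hf hg i => ?_)
    (by simpa only [map_zero, sub_nonpos] using h₀) t
  · simpa only [map_zero, sub_nonpos] using hflow
  · rw [sub_zero]
    rcases le_total (f (bdry p i)) (g (bdry p i)) with hle | hle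
    · rw [posPart_of_nonpos (sub_nonpos.2 hle), sub_zero, add_zero]
    · rw [posPart_of_nonneg (sub_nonneg.2 hle), sub_sub_cancel, add_sub_cancel]
      exact h t f g hf hg i hle

theorem IsUnitSimplex.flow_le_flow_of_le (hp : IsUnitSimplex p)
    (hu : IsGradientFlow (perturbedEnergy p μ B) u₀ u)
    (hv : IsGradientFlow (perturbedEnergy p μ B) v₀ v) (h₀ : u₀ ≤ v₀) (t : ℝ≥0) : u t ≤ v t :=
  hp.flow_le_flow hu hv (fun _ _ _ _ _ _ _ => (add_comm _ _).le) h₀ t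

theorem IsUnitSimplex.abs_flow_sub_flow_le_const (hp : IsUnitSimplex p)
    (hB : ∀ i, ConvexEnergy (B i)) (hu : IsGradientFlow (perturbedEnergy p μ B) u₀ u)
    (hv : IsGradientFlow (perturbedEnergy p μ B) v₀ v) {k : ℝ} (hk : 0 ≤ k)
    (h₀ : |u₀ - v₀| ≤ Lp.const 2 μ k) (t : ℝ≥0) : |u t - v t| ≤ Lp.const 2 μ k := by
  have htrunc : ∀ f g : Lp ℝ 2 μ, perturbedEnergy p μ B (f - (f - g - Lp.const 2 μ k)⁺)
      + perturbedEnergy p μ B (g + (f - g - Lp.const 2 μ k)⁺) ≤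
      perturbedEnergy p μ B f + perturbedEnergy p μ B g := fun f g =>
    hp.perturbedEnergy_truncation_le k fun _ _ _ _ i => (hB i).truncation_le hk _ _
  rw [abs_le', neg_sub] at h₀ ⊢
  exact ⟨hu.sub_le_of_posPart hv (fun _ => htrunc _ _) h₀.1 t,
    hv.sub_le_of_posPart hu (fun _ => htrunc _ _) h₀.2 t⟩

theorem IsUnitSimplex.abs_flow_le_flow (hp : IsUnitSimplex p)
    (hu : IsGradientFlow (perturbedEnergy p μ B') u₀ u)
    (hv : IsGradientFlow (perturbedEnergy p μ B) v₀ v) (hv_nonneg : ∀ t, 0 ≤ v t)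
    (hD : ∀ i, IsBimonotone fun s => extSub (B' i s) (B i |s|)) (h₀ : |u₀| ≤ v₀) (t : ℝ≥0) :
    |u t| ≤ v t := by
  have hneg := hu.neg
  simp only [← perturbedEnergy_neg] at hneg
  rw [abs_le'] at h₀ ⊢
  refine ⟨hp.flow_le_flow hu hv (fun t f g _ hg i hgf => extSub_le_extSub ?_) h₀.1 t,
    hp.flow_le_flow hneg hv (fun t f g _ hg i hgf => extSub_le_extSub ?_) h₀.2 t⟩
  all_goals
    have hg_nonneg : 0 ≤ g (bdry p i) := nonneg_of_ae_eq (hv_nonneg t) hg (bdry p i)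
    have hf_nonneg := hg_nonneg.trans hgf
  · simpa only [abs_of_nonneg, hg_nonneg, hf_nonneg] using (hD i).2 hg_nonneg hf_nonneg hgf
  · simpa only [abs_neg, abs_of_nonneg, hg_nonneg, hf_nonneg] using
      (hD i).1 (neg_nonpos.2 hf_nonneg) (neg_nonpos.2 hg_nonneg) (neg_le_neg hgf)

end Flow

end Gasket

namespace Gasket

/-! ### The semigroups generated by the perturbed energies -/

section Semigroup

variable {N : ℕ} {p : Fin N → Space N} {μ : Measure (gasket p)} [IsFiniteMeasure μ]
  [μ.IsOpenPosMeasure] {B B' : Fin N → ℝ → ℝ≥0∞} {S S' : ℝ≥0 → Lp ℝ 2 μ → Lp ℝ 2 μ}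

theorem IsUnitSimplex.existsUnique_isGeneratedBy (hp : IsUnitSimplex p)
    (hdense : Dense (effDomain (perturbedEnergy p μ B)))
    (hlsc : LowerSemicontinuous (perturbedEnergy p μ B))
    (hconv : ConvexEnergy (perturbedEnergy p μ B)) :
    ∃! S : ℝ≥0 → Lp ℝ 2 μ → Lp ℝ 2 μ, IsGeneratedBy (perturbedEnergy p μ B) S := by
  choose S hS using fun u₀ : Lp ℝ 2 μ => hconv.exists_isGradientFlow hlsc (hdense u₀)
  refine ⟨fun t u₀ => S u₀ t, fun u₀ _ => hS u₀, fun T hT => ?_⟩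
  funext t u₀
  exact le_antisymm (hp.flow_le_flow_of_le (hT u₀ (hdense u₀)) (hS u₀) le_rfl t)
    (hp.flow_le_flow_of_le (hS u₀) (hT u₀ (hdense u₀)) le_rfl t)

theorem IsUnitSimplex.isOrderPreserving (hp : IsUnitSimplex p)
    (hdense : Dense (effDomain (perturbedEnergy p μ B)))
    (hS : IsGeneratedBy (perturbedEnergy p μ B) S) : IsOrderPreserving S :=
  fun t u₀ v₀ h₀ => hp.flow_le_flow_of_le (hS u₀ (hdense u₀)) (hS v₀ (hdense v₀)) h₀ t

theorem IsUnitSimplex.isPositiveSG (hp : IsUnitSimplex p) (hB : ∀ i, B i 0 = 0)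
    (hdense : Dense (effDomain (perturbedEnergy p μ B)))
    (hS : IsGeneratedBy (perturbedEnergy p μ B) S) : IsPositiveSG S := fun t u₀ h₀ =>
  hp.flow_le_flow_of_le (isGradientFlow_zero (perturbedEnergy_zero hB)) (hS u₀ (hdense u₀)) h₀ t

theorem IsUnitSimplex.isLinftyContractive (hp : IsUnitSimplex p) (hB : ∀ i, ConvexEnergy (B i))
    (hdense : Dense (effDomain (perturbedEnergy p μ B)))
    (hS : IsGeneratedBy (perturbedEnergy p μ B) S) : IsLinftyContractive S := fun t u₀ v₀ => by
  rcases eq_or_ne (eLpNorm (u₀ - v₀ : Lp ℝ 2 μ) ∞ μ) ∞ with htop | hfin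
  · rw [htop]
    exact le_top
  have hnorm := (ENNReal.ofReal_toReal hfin).symm
  rw [hnorm, ← abs_le_const_iff_eLpNorm_top_le ENNReal.toReal_nonneg]
  exact hp.abs_flow_sub_flow_le_const hB (hS u₀ (hdense u₀)) (hS v₀ (hdense v₀))
    ENNReal.toReal_nonneg ((abs_le_const_iff_eLpNorm_top_le ENNReal.toReal_nonneg).2 hnorm.le) t

theorem IsUnitSimplex.isDominatedBy (hp : IsUnitSimplex p) (hB : ∀ i, B i 0 = 0)
    (hdense : Dense (effDomain (perturbedEnergy p μ B)))
    (hdense' : Dense (effDomain (perturbedEnergy p μ B')))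
    (hS : IsGeneratedBy (perturbedEnergy p μ B) S)
    (hS' : IsGeneratedBy (perturbedEnergy p μ B') S')
    (hD : ∀ i, IsBimonotone fun s => extSub (B' i s) (B i |s|)) : IsDominatedBy S' S :=
  ⟨hp.isOrderPreserving hdense hS, fun t u₀ v₀ h₀ =>
    hp.abs_flow_le_flow (hS' u₀ (hdense' u₀)) (hS v₀ (hdense v₀))
      (fun τ => hp.isPositiveSG hB hdense hS τ v₀ ((abs_nonneg u₀).trans h₀)) hD h₀ t⟩

theorem IsUnitSimplex.isTotallyDominatedBy (hp : IsUnitSimplex p) (hB : ∀ i, B i 0 = 0)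
    (hdense : Dense (effDomain (perturbedEnergy p μ B)))
    (hdense' : Dense (effDomain (perturbedEnergy p μ B')))
    (hS : IsGeneratedBy (perturbedEnergy p μ B) S)
    (hS' : IsGeneratedBy (perturbedEnergy p μ B') S')
    (hD : ∀ i, IsBimonotone fun s => extSub (B' i s) (B i |s|))
    (hD_neg : ∀ i, IsBimonotone fun s => extSub (B' i s) (B i (-|s|))) :
    IsTotallyDominatedBy S' S := by
  have hneg : (fun f => perturbedEnergy p μ B (-f)) = perturbedEnergy p μ fun i s => B i (-s) :=
    funext fun f => (perturbedEnergy_neg f).symm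
  have hdense_neg : Dense (effDomain fun f => perturbedEnergy p μ B (-f)) :=
    hdense.preimage (Homeomorph.neg (Lp ℝ 2 μ)).isOpenMap
  have hS_neg := hS.neg
  rw [hneg] at hdense_neg hS_neg
  exact ⟨hp.isDominatedBy hB hdense hdense' hS hS' hD,
    hp.isDominatedBy (fun i => by rw [neg_zero, hB]) hdense_neg hdense' hS_neg hS' hD_neg⟩

end Semigroup

end Gasket

end

theorem theorem3p2_general (N : ℕ)
    (p : Fin N → Gasket.Space N) (hp : Gasket.IsUnitSimplex p)
    (μ : Measure (Gasket.gasket p)) [IsFiniteMeasure μ] [μ.IsOpenPosMeasure]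
    (hμ : μ (Set.range (Gasket.bdry p)) = 0)
    (B : Fin N → ℝ → ℝ≥0∞) (hB : ∀ i, B i 0 = 0) :
    Dense (effDomain (Gasket.perturbedEnergy p μ B)) ∧
    (LowerSemicontinuous (Gasket.perturbedEnergy p μ B) →
      ConvexEnergy (Gasket.perturbedEnergy p μ B) →
      ∃! S : ℝ≥0 → Lp ℝ 2 μ → Lp ℝ 2 μ, IsGeneratedBy (Gasket.perturbedEnergy p μ B) S) ∧
    ∀ S : ℝ≥0 → Lp ℝ 2 μ → Lp ℝ 2 μ, IsGeneratedBy (Gasket.perturbedEnergy p μ B) S →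
      (IsPositiveSG S ∧ IsOrderPreserving S) ∧
      ((∀ i, ConvexEnergy (B i)) → IsLinftyContractive S) ∧
      ∀ B' : Fin N → ℝ → ℝ≥0∞, (∀ i, B' i 0 = 0) →
        ∀ S' : ℝ≥0 → Lp ℝ 2 μ → Lp ℝ 2 μ, IsGeneratedBy (Gasket.perturbedEnergy p μ B') S' →
          ((∀ i, IsBimonotone fun s => extSub (B' i s) (B i |s|)) → IsDominatedBy S' S) ∧
          ((∀ i, IsBimonotone fun s => extSub (B' i s) (B i |s|)) →
            (∀ i, IsBimonotone fun s => extSub (B' i s) (B i (-|s|))) →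
              IsTotallyDominatedBy S' S) := by
  have hdense := hp.dense_effDomain hμ hB
  refine ⟨hdense, hp.existsUnique_isGeneratedBy hdense, fun S hS =>
    ⟨⟨hp.isPositiveSG hB hdense hS, hp.isOrderPreserving hdense hS⟩,
      fun hBc => hp.isLinftyContractive hBc hdense hS, fun B' hB' S' hS' => ?_⟩⟩
  have hdense' := hp.dense_effDomain hμ hB'
  exact ⟨hp.isDominatedBy hB hdense hdense' hS hS',
    hp.isTotallyDominatedBy hB hdense hdense' hS hS'⟩

theorem theorem3p2 (N : ℕ) (hN : 2 ≤ N)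
    (p : Fin N → Gasket.Space N) (hp : ∀ i j, i ≠ j → dist (p i) (p j) = 1)
    (μ : Measure (Gasket.gasket p)) [IsFiniteMeasure μ] [μ.IsOpenPosMeasure]
    (hμ : μ (Set.range (Gasket.bdry p)) = 0)
    (B : Fin N → ℝ → ℝ≥0∞) (hB : ∀ i, B i 0 = 0)
    (hlsc : LowerSemicontinuous (Gasket.perturbedEnergy p μ B))
    (hconv : ConvexEnergy (Gasket.perturbedEnergy p μ B)) :
    -- the semigroup generated by `W_B` exists, is unique, and lives on all of `L²_μ(V)`
    Dense (effDomain (Gasket.perturbedEnergy p μ B)) ∧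
    (∃! S : ℝ≥0 → Lp ℝ 2 μ → Lp ℝ 2 μ, IsGeneratedBy (Gasket.perturbedEnergy p μ B) S) ∧
    ∀ S : ℝ≥0 → Lp ℝ 2 μ → Lp ℝ 2 μ, IsGeneratedBy (Gasket.perturbedEnergy p μ B) S →
      (IsPositiveSG S ∧ IsOrderPreserving S) ∧
      ((∀ i, ConvexEnergy (B i)) → IsLinftyContractive S) ∧
      ∀ B' : Fin N → ℝ → ℝ≥0∞, (∀ i, B' i 0 = 0) →
        LowerSemicontinuous (Gasket.perturbedEnergy p μ B') →
        ConvexEnergy (Gasket.perturbedEnergy p μ B') →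
        ∀ S' : ℝ≥0 → Lp ℝ 2 μ → Lp ℝ 2 μ, IsGeneratedBy (Gasket.perturbedEnergy p μ B') S' →
          ((∀ i, IsBimonotone fun s => extSub (B' i s) (B i |s|)) → IsDominatedBy S' S) ∧
          ((∀ i, IsBimonotone fun s => extSub (B' i s) (B i |s|)) →
            (∀ i, IsBimonotone fun s => extSub (B' i s) (B i (-|s|))) →
              IsTotallyDominatedBy S' S) :=
  have ⟨hdense, hexists, hproperties⟩ := theorem3p2_general N p hp μ hμ B hB
  ⟨hdense, hexists hlsc hconv, fun S hS =>
    (hproperties S hS).imp_right (And.imp_right fun h B' hB' _ _ => h B' hB')⟩
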